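/- Let $1\le q\le p\le n$ and let $A\in\mathbb{R}^{m\times n}$. For a real symmetric $p\times p$ matrix $B$ with eigenvalues $\lambda_1,\dots,\lambda_p$ (with multiplicity), let $s_q(B)=\sum_{1\le i_1<\dots<i_q\le p}\lambda_{i_1}\cdots\lambda_{i_q}$, and let $\mathrm{St}(n,p)=\{X\in\mathbb{R}^{n\times p}: X^TX=I_p\}$. Put $$f_{s_q}(X)=\frac{s_q(X^TA^TAX)}{s_q(X^TX)}$$ and consider the problem of maximising $f_{s_q}$ over $\mathrm{St}(n,p)$. A $p$-leading right singular factor of $A$ is a matrix $V_p$ formed by the first $p$ columns of $V$ in some singular value decomposition $A=U\Sigma V^T$ with $U,V$ orthogonal and $\Sigma\in\mathbb{R}^{m\times n}$ diagonal with nonnegative, nonincreasing diagonal entries. A point $X\in \mathrm{St}(n,p)$ is stationary if there is a symmetric $\Lambda\in\mathbb{R}^{p\times p}$ such that the gradient at $X$ of the Lagrangian $L_\Lambda(Y)=f_{s_q}(Y)+\langle Y^TY-I_p,\Lambda\rangle$ vanishes, where $\langle\cdot,\cdot\rangle$ is the Frobenius inner product. A stationary point $X$, with multiplier $\Lambda$,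 is a strict saddle if there are $\Delta_+,\Delta_-\in\mathbb{R}^{n\times p}$ with $X^T\Delta_\pm+\Delta_\pm^TX=0$ such that $\nabla^2L_\Lambda(X)[\Delta_+,\Delta_+]>0$ and $\nabla^2L_\Lambda(X)[\Delta_-,\Delta_-]<0$. Then: i) Let $X\in\mathrm{St}(n,p)$. If $\mathrm{range}(X)=\mathrm{range}(V_p)$ for some $p$-leading right singular factor $V_p$ of $A$, then $X$ is a global maximiser of $f_{s_q}$ over $\mathrm{St}(n,p)$. Conversely, if $\mathrm{rank}(A)\ge q$ (or $A=0$, or $p=n$), then for every global maximiser $X$ there is a $p$-leading right singular factor $V_p$ of $A$ with $\mathrm{range}(X)=\mathrm{range}(V_p)$. ii) Every local maximiser of $f_{s_q}$ on $\mathrm{St}(n,p)$ is a global maximiser, every local minimiser of $f_{s_q}$ on $\mathrm{St}(n,p)$ is a global minimiser, and every stationary point that is neither a local maximiser nor a local minimiser is a strict saddle. -/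

import Mathlib

open Matrix

namespace ElemSymPCA

noncomputable section

/-- The Stiefel manifold `St(n,p)`: real `n × p` matrices with orthonormal columns. -/
def stiefel (n p : ℕ) : Set (Matrix (Fin n) (Fin p) ℝ) :=
  {X | Xᵀ * X = 1}

/-- The `q`-th elementary symmetric polynomial of the eigenvalues (with multiplicity) of a real
symmetric matrix. -/
def esymmEigenvalues {p : ℕ} (q : ℕ) (B : Matrix (Fin p) (Fin p) ℝ) (hB : B.IsHermitian) : ℝ :=
  ∑ T ∈ Finset.powersetCard q (Finset.univ : Finset (Fin p)), ∏ i ∈ T, hB.eigenvalues i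

theorem isHermitian_transpose_mul_self {m p : ℕ} (Y : Matrix (Fin m) (Fin p) ℝ) :
    (Yᵀ * Y).IsHermitian := by
  simpa using Matrix.isHermitian_conjTranspose_mul_self Y

theorem isHermitian_gram {m n p : ℕ} (A : Matrix (Fin m) (Fin n) ℝ)
    (X : Matrix (Fin n) (Fin p) ℝ) : (Xᵀ * Aᵀ * A * X).IsHermitian := by
  simpa [Matrix.transpose_mul, Matrix.mul_assoc] using isHermitian_transpose_mul_self (A * X)

/-- The objective `X ↦ s_q(Xᵀ Aᵀ A X) / s_q(Xᵀ X)` on all real `n × p` matrices. -/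
def inflation {m n p : ℕ} (A : Matrix (Fin m) (Fin n) ℝ) (q : ℕ)
    (X : Matrix (Fin n) (Fin p) ℝ) : ℝ :=
  esymmEigenvalues q (Xᵀ * Aᵀ * A * X) (isHermitian_gram A X) /
    esymmEigenvalues q (Xᵀ * X) (isHermitian_transpose_mul_self X)

/-- `Vp` is a `p`-leading right singular factor of `A`: it consists of the first `p` columns of
the matrix `V` of some full singular value decomposition `A = U Σ Vᵀ`, where `U` and `V` are
orthogonal and the `m × n` matrix `Σ` is diagonal with nonnegative nonincreasing diagonal.
(Only the values `σ i` with `i < min m n` enter.) -/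
def IsLeadingRightSingularFactor {m n p : ℕ} (hpn : p ≤ n) (A : Matrix (Fin m) (Fin n) ℝ)
    (Vp : Matrix (Fin n) (Fin p) ℝ) : Prop :=
  ∃ U ∈ Matrix.orthogonalGroup (Fin m) ℝ, ∃ V ∈ Matrix.orthogonalGroup (Fin n) ℝ, ∃ σ : ℕ → ℝ,
    Antitone σ ∧ (∀ i, 0 ≤ σ i) ∧
    A = U * (Matrix.of fun (i : Fin m) (j : Fin n) => if (i : ℕ) = (j : ℕ) then σ i else 0) * Vᵀ ∧
    Vp = V.submatrix id (Fin.castLE hpn)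

/-- The Lagrangian `f(X) + ⟨Xᵀ X - I, Λ⟩` of the problem over the Stiefel manifold, with the
Frobenius inner product. -/
def lagrangian {m n p : ℕ} (A : Matrix (Fin m) (Fin n) ℝ) (q : ℕ) (Λ : Matrix (Fin p) (Fin p) ℝ)
    (X : Matrix (Fin n) (Fin p) ℝ) : ℝ :=
  inflation A q X + ((Xᵀ * X - 1)ᵀ * Λ).trace

/-- `Λ` is a symmetric Lagrange multiplier at `X`: the gradient in `X` of the Lagrangian vanishes.
Near the Stiefel manifold the objective is a quotient of polynomials with nonvanishing
denominator, so the vanishing of all directional derivatives is the vanishing of the gradient. -/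
def IsMultiplier {m n p : ℕ} (A : Matrix (Fin m) (Fin n) ℝ) (q : ℕ)
    (X : Matrix (Fin n) (Fin p) ℝ) (Λ : Matrix (Fin p) (Fin p) ℝ) : Prop :=
  Λ.IsSymm ∧
    ∀ Δ : Matrix (Fin n) (Fin p) ℝ, deriv (fun t : ℝ => lagrangian A q Λ (X + t • Δ)) 0 = 0

/-- Stationary point of the problem over the Stiefel manifold: the gradient of the objective lies
in the normal space `{X S | S symmetric}` of the manifold at `X`. -/
def IsStationaryPoint {m n p : ℕ} (A : Matrix (Fin m) (Fin n) ℝ) (q : ℕ)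
    (X : Matrix (Fin n) (Fin p) ℝ) : Prop :=
  X ∈ stiefel n p ∧ ∃ Λ, IsMultiplier A q X Λ

/-- The tangent space of the Stiefel manifold at `X`. -/
def tangentSpace {n p : ℕ} (X : Matrix (Fin n) (Fin p) ℝ) : Set (Matrix (Fin n) (Fin p) ℝ) :=
  {Δ | Xᵀ * Δ + Δᵀ * X = 0}

/-- The Hessian quadratic form `∇²L(X)[Δ,Δ]` of the Lagrangian. At a stationary point and for
tangent `Δ` this is the Riemannian Hessian of the objective restricted to the manifold. -/
def hessian {m n p : ℕ} (A : Matrix (Fin m) (Fin n) ℝ) (q : ℕ) (Λ : Matrix (Fin p) (Fin p) ℝ)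
    (X Δ : Matrix (Fin n) (Fin p) ℝ) : ℝ :=
  iteratedDeriv 2 (fun t : ℝ => lagrangian A q Λ (X + t • Δ)) 0

/-- Strict saddle point: a stationary point with a tangent direction of strictly positive
curvature (ascent) and a tangent direction of strictly negative curvature (descent). -/
def IsStrictSaddle {m n p : ℕ} (A : Matrix (Fin m) (Fin n) ℝ) (q : ℕ)
    (X : Matrix (Fin n) (Fin p) ℝ) : Prop :=
  X ∈ stiefel n p ∧ ∃ Λ, IsMultiplier A q X Λ ∧
    (∃ Δ ∈ tangentSpace X, 0 < hessian A q Λ X Δ) ∧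
    (∃ Δ ∈ tangentSpace X, hessian A q Λ X Δ < 0)

end

end ElemSymPCA

/-!
Write `M = Aᵀ A` and let `e_q` be the elementary symmetric function of a matrix, defined as the
coefficient of `X ^ q` in `det (1 + X B)` (`esymmMatrix`). On the Stiefel manifold the objective is
`e_q(Xᵀ M X)` up to a positive constant. It is invariant under `X ↦ X Q` with `Q` orthogonal, so
`X` may be assumed to diagonalise the compression: `Xᵀ M X = diag d`.

**Local conditions.** Replace the `i`-th column `x` of such a frame by `α x + β y`, with `y` a unit
vector orthogonal to the frame. The compression changes in its `i`-th row and column only, and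
`e_q` becomes `g β + (α² dᵢ + 2 α β x·My + β² y·My) h` (`exists_esymmMatrix_replaceCol`), where `g`
is an even polynomial, because a reflection changes the sign of the off-diagonal terms, and
`h = e_{q-1}(d without dᵢ)`. If the objective is positive at `X` then `h > 0`. Hence the first-order
conditions, for local extrema as well as for stationary points, force `x·My = 0`, that is, the range
of `X` is invariant under `M` (`mul_eq_of_cross_eq_zero`). Then `g` is constant, and the second-order
term is a positive multiple of `y·My - dᵢ` (`exists_inflation_rotation`, `exists_hessian_eq`).

**Global conditions.** If the range of `X` is invariant and `y·My ≤ dᵢ` for all `i` and `y`, put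
`μ = min dᵢ`; then `M ≤ μ + X (diag d - μ) Xᵀ` in the Loewner order. Since `e_q` is Loewner monotone
on positive semidefinite matrices (`esymmMatrix_mono`) and `e_q(μ + U V) = e_q(μ + V U)`, the frame
`X` is a global maximiser (`esymmMatrix_compression_le`); reversing the inequalities gives global
minimisers (`le_esymmMatrix_compression`). Therefore a stationary point with positive objective that
is not a global maximiser (minimiser) has a direction of ascent (descent) of second order.

**Vanishing objective.** A point with objective `0` is a global minimiser. It is a local maximiser
only if the objective vanishes identically, because frames on which `A` has rank at least `q` are
dense as soon as `q ≤ rank A` (`stiefel_subset_closure_rank_ge`).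

**Singular factors.** The frames satisfying the global conditions for maximality
(`IsDominantFrame`) with sorted eigenvalues are exactly the leading right singular factors:
completing one by sorted eigenvectors on the orthogonal complement yields a singular value
decomposition (`IsDominantFrame.isLeadingRightSingularFactor`).
-/

open Matrix

namespace ElemSymPCA

/-! ### Elementary symmetric functions of a matrix -/

open Polynomial in
/-- The `q`-th elementary symmetric function of a square matrix over any commutative ring: the
coefficient of `X ^ q` in `det (1 + X B)`. -/
noncomputable def esymmMatrix {ι R : Type*} [Fintype ι] [DecidableEq ι] [CommRing R] (q : ℕ)
    (B : Matrix ι ι R) : R :=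
  (det (1 + (X : R[X]) • B.map C)).coeff q

/-- The coordinate projection that kills the `i`-th basis vector. -/
def killCoord {ι : Type*} [DecidableEq ι] (R : Type*) [Zero R] [One R] (i : ι) : Matrix ι ι R :=
  diagonal fun j => if j = i then 0 else 1

theorem killCoord_transpose {ι : Type*} [DecidableEq ι] (R : Type*) [Zero R] [One R] (i : ι) :
    (killCoord R i)ᵀ = killCoord R i :=
  diagonal_transpose _

section CommRing

variable {ι R : Type*} [Fintype ι] [DecidableEq ι] [CommRing R]

open Polynomial in
theorem esymmMatrix_diagonal (q : ℕ) (d : ι → R) :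
    esymmMatrix q (diagonal d) =
      ∑ T ∈ Finset.powersetCard q (Finset.univ : Finset ι), ∏ i ∈ T, d i := by
  have h : (1 : Matrix ι ι R[X]) + (X : R[X]) • (diagonal d).map C =
      diagonal fun i => 1 + X * C (d i) := by
    rw [← diagonal_one, diagonal_map (map_zero C), ← diagonal_smul, diagonal_add]
    rfl
  rw [esymmMatrix, h, det_diagonal, Finset.prod_one_add, finsetSum_coeff,
    ← Finset.sum_filter_add_sum_filter_not _ (fun T => T.card = q)]
  refine (add_eq_left.2 (Finset.sum_eq_zero ?_)).trans ?_
  rotate_left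
  · rw [← Finset.powersetCard_eq_filter]
    refine Finset.sum_congr rfl fun T hT => ?_
    rw [Finset.prod_mul_distrib, Finset.prod_const, ← _root_.map_prod C, coeff_X_pow_mul',
      (Finset.mem_powersetCard.1 hT).2, if_pos le_rfl, Nat.sub_self, coeff_C_zero]
  · intro T hT
    rw [Finset.prod_mul_distrib, Finset.prod_const, ← map_prod, coeff_mul_C, coeff_X_pow,
      if_neg, zero_mul]
    exact fun h => (Finset.mem_filter.1 hT).2 h.symm

/-- Sylvester's identity for products of square matrices, shifted by a scalar. -/
theorem det_smul_one_add_mul_comm (a : R) (U V : Matrix ι ι R) :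
    det (a • 1 + U * V) = det (a • 1 + V * U) := by
  have h (U V : Matrix ι ι R) : det (a • 1 + U * V) = ((-U) * V).charpoly.eval a := by
    rw [eval_charpoly, scalar_apply, ← smul_one_eq_diagonal, Matrix.neg_mul, sub_neg_eq_add]
  rw [h, h, charpoly_mul_comm, Matrix.mul_neg, Matrix.neg_mul]

open Polynomial in
theorem esymmMatrix_smul_one_add_mul_comm (q : ℕ) (a : R) (U V : Matrix ι ι R) :
    esymmMatrix q (a • 1 + U * V) = esymmMatrix q (a • 1 + V * U) := by
  have h (U V : Matrix ι ι R) : (1 : Matrix ι ι R[X]) + (X : R[X]) • (a • 1 + U * V).map C =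
      (1 + X * C a : R[X]) • (1 : Matrix ι ι R[X]) + ((X : R[X]) • U.map C) * V.map C := by
    rw [Matrix.map_add C (fun _ _ => C_add), Matrix.map_mul, smul_add, add_smul, one_smul, add_assoc,
      Matrix.smul_mul, mul_smul]
    congr 3
    ext i j : 1
    by_cases hij : i = j <;> simp [hij]
  rw [esymmMatrix, esymmMatrix, h, h, det_smul_one_add_mul_comm, Matrix.mul_smul, Matrix.smul_mul]

theorem esymmMatrix_mul_comm (q : ℕ) (U V : Matrix ι ι R) :
    esymmMatrix q (U * V) = esymmMatrix q (V * U) := by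
  simpa using esymmMatrix_smul_one_add_mul_comm q 0 U V

theorem esymmMatrix_conj (q : ℕ) {Q : Matrix ι ι R} (hQ : Qᵀ * Q = 1) (B : Matrix ι ι R) :
    esymmMatrix q (Qᵀ * B * Q) = esymmMatrix q B := by
  rw [esymmMatrix_mul_comm, ← Matrix.mul_assoc, mul_eq_one_comm.1 hQ, Matrix.one_mul]

open Polynomial in
theorem esymmMatrix_map {S : Type*} [CommRing S] (q : ℕ) (φ : R →+* S) (B : Matrix ι ι R) :
    esymmMatrix q (B.map φ) = φ (esymmMatrix q B) := by
  rw [esymmMatrix, esymmMatrix, ← Polynomial.coeff_map, ← coe_mapRingHom, RingHom.map_det]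
  congr 2
  ext i j : 1
  by_cases hij : i = j <;> simp [hij]

theorem killCoord_mul_self (i : ι) : killCoord R i * killCoord R i = killCoord R i := by
  rw [killCoord, diagonal_mul_diagonal]
  congr 1
  ext j
  split_ifs <;> simp

theorem killCoord_conj_apply (i : ι) (B : Matrix ι ι R) (j k : ι) :
    (killCoord R i * B * killCoord R i) j k = if j = i ∨ k = i then 0 else B j k := by
  rw [killCoord, mul_diagonal, diagonal_mul]
  by_cases hj : j = i <;> by_cases hk : k = i <;> simp [hj, hk]

open Polynomial in
/-- `esymmMatrix` is affine in each diagonal entry, because the determinant is linear in each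
row. -/
theorem esymmMatrix_add_single (q : ℕ) (B : Matrix ι ι R) (i : ι) (c : R) :
    esymmMatrix (q + 1) (B + single i i c) =
      esymmMatrix (q + 1) B + c * esymmMatrix q (killCoord R i * B * killCoord R i) := by
  set P : Matrix ι ι R[X] := 1 + (X : R[X]) • B.map C with hP
  have h1 : 1 + (X : R[X]) • (B + single i i c).map C =
      P.updateRow i (P i + (X * C c) • Pi.single i 1) := by
    ext j k : 1
    by_cases hj : j = i
    · subst hj
      rw [updateRow_self]
      by_cases hk : k = j
      · subst hk
        simp [hP]
        ring
      · simp [hP, hk, Ne.symm hk]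
    · rw [updateRow_ne hj]
      simp [hP, Ne.symm hj]
  have h2 : P.updateRow i (Pi.single i 1) = 1 + (X : R[X]) • (killCoord R i * B).map C := by
    ext j k : 1
    by_cases hj : j = i
    · subst hj
      by_cases hk : k = j
      · subst hk
        simp [killCoord, diagonal_mul]
      · simp [killCoord, diagonal_mul, hk, Ne.symm hk]
    · rw [updateRow_ne hj]
      simp [hP, killCoord, diagonal_mul, hj]
  have h3 : esymmMatrix q (killCoord R i * B * killCoord R i) = esymmMatrix q (killCoord R i * B) := by
    rw [esymmMatrix_mul_comm, ← Matrix.mul_assoc, killCoord_mul_self]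
  rw [h3, esymmMatrix, h1, det_updateRow_add, det_updateRow_smul, h2, updateRow_eq_self, coeff_add,
    mul_comm X, mul_assoc, coeff_C_mul, coeff_X_mul]
  rfl

end CommRing

theorem mul_transpose_eq_one {p : ℕ} {Q : Matrix (Fin p) (Fin p) ℝ}
    (hQ : Qᵀ * Q = 1) : Q * Qᵀ = 1 := mul_eq_one_comm.1 hQ

theorem exists_orthogonal_diagonalization {p : ℕ} {B : Matrix (Fin p) (Fin p) ℝ}
    (hB : B.IsHermitian) :
    ∃ Q : Matrix (Fin p) (Fin p) ℝ, Qᵀ * Q = 1 ∧ Qᵀ * B * Q = diagonal hB.eigenvalues := by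
  have hU := mem_unitaryGroup_iff'.1 hB.eigenvectorUnitary.2
  refine ⟨hB.eigenvectorUnitary, by simpa [star_eq_conjTranspose] using hU, ?_⟩
  have h := hB.conjStarAlgAut_star_eigenvectorUnitary
  rw [Unitary.conjStarAlgAut_apply] at h
  simpa [star_eq_conjTranspose, Function.comp_def] using h

theorem exists_sorted_orthogonal_diagonalization {p : ℕ} {B : Matrix (Fin p) (Fin p) ℝ}
    (hB : B.IsHermitian) :
    ∃ (Q : Matrix (Fin p) (Fin p) ℝ) (d : Fin p → ℝ), Qᵀ * Q = 1 ∧ Antitone d ∧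
      Qᵀ * B * Q = diagonal d := by
  obtain ⟨Q, hQ, hd⟩ := exists_orthogonal_diagonalization hB
  let τ := Tuple.sort (fun i => - hB.eigenvalues i)
  refine ⟨Q.submatrix id τ, hB.eigenvalues ∘ τ, ?_, ?_, ?_⟩
  · rw [transpose_submatrix, ← submatrix_mul _ _ _ _ _ Function.bijective_id, hQ,
      submatrix_one_equiv]
  · intro i j hij
    have := Tuple.monotone_sort (fun i => - hB.eigenvalues i) hij
    simpa using this
  · have h : (Q.submatrix id τ)ᵀ * B * Q.submatrix id τ = (Qᵀ * B * Q).submatrix τ τ := by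
      rw [← Matrix.submatrix_id_id B]
      simp only [transpose_submatrix, ← submatrix_mul _ _ _ _ _ Function.bijective_id]
      rw [submatrix_id_id]
    rw [h, hd, submatrix_diagonal_equiv]

theorem esymmEigenvalues_eq {p : ℕ} (q : ℕ) (B : Matrix (Fin p) (Fin p) ℝ) (hB : B.IsHermitian) :
    esymmEigenvalues q B hB = esymmMatrix q B := by
  obtain ⟨Q, hQ, hd⟩ := exists_orthogonal_diagonalization hB
  rw [← esymmMatrix_conj q hQ B, hd, esymmMatrix_diagonal, esymmEigenvalues]

/-! ### Positive semidefinite matrices -/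

section PosSemidef

variable {p : ℕ}

theorem transpose_eq_of_posSemidef {B : Matrix (Fin p) (Fin p) ℝ} (hB : B.PosSemidef) : Bᵀ = B :=
  isHermitian_iff_isSymm.1 hB.1

theorem esymmMatrix_nonneg (q : ℕ) {B : Matrix (Fin p) (Fin p) ℝ} (hB : B.PosSemidef) :
    0 ≤ esymmMatrix q B := by
  rw [← esymmEigenvalues_eq q B hB.1, esymmEigenvalues]
  exact Finset.sum_nonneg fun T _ => Finset.prod_nonneg fun i _ => hB.eigenvalues_nonneg i

theorem posSemidef_transpose_mul_mul {k l : ℕ} {B : Matrix (Fin k) (Fin k) ℝ} (hB : B.PosSemidef)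
    (Q : Matrix (Fin k) (Fin l) ℝ) : (Qᵀ * B * Q).PosSemidef := by
  simpa using hB.conjTranspose_mul_mul_same Q

/-- A positive semidefinite matrix has `q`-th elementary symmetric function positive exactly when
at least `q` of its eigenvalues are nonzero. -/
theorem esymmMatrix_pos_iff (q : ℕ) {B : Matrix (Fin p) (Fin p) ℝ} (hB : B.PosSemidef) :
    0 < esymmMatrix q B ↔ q ≤ B.rank := by
  rw [← esymmEigenvalues_eq q B hB.1, esymmEigenvalues, hB.1.rank_eq_card_non_zero_eigs,
    Fintype.card_subtype]
  have hnn : ∀ T ∈ Finset.powersetCard q (Finset.univ : Finset (Fin p)),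
      0 ≤ ∏ i ∈ T, hB.1.eigenvalues i :=
    fun T _ => Finset.prod_nonneg fun i _ => hB.eigenvalues_nonneg i
  constructor
  · intro h
    obtain ⟨T, hT, hpos⟩ := Finset.exists_lt_of_sum_lt (f := fun _ => (0 : ℝ))
      (by simpa using h)
    rw [← (Finset.mem_powersetCard.1 hT).2]
    refine Finset.card_le_card fun i hi => Finset.mem_filter.2 ⟨Finset.mem_univ _, fun h0 => ?_⟩
    exact hpos.ne' (Finset.prod_eq_zero hi h0)
  · intro h
    obtain ⟨T, hTs, hT⟩ := Finset.exists_subset_card_eq h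
    refine Finset.sum_pos' hnn ⟨T, Finset.mem_powersetCard.2 ⟨Finset.subset_univ _, hT⟩, ?_⟩
    exact Finset.prod_pos fun i hi =>
      (hB.eigenvalues_nonneg i).lt_of_ne' (Finset.mem_filter.1 (hTs hi)).2

theorem esymmMatrix_le_add_single (q : ℕ) {B : Matrix (Fin p) (Fin p) ℝ} (hB : B.PosSemidef)
    (i : Fin p) {c : ℝ} (hc : 0 ≤ c) : esymmMatrix q B ≤ esymmMatrix q (B + single i i c) := by
  cases q with
  | zero => simp [esymmMatrix, coeff_det_one_add_X_smul_eq_sum_minors]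
  | succ q =>
    rw [esymmMatrix_add_single]
    have := esymmMatrix_nonneg q (posSemidef_transpose_mul_mul hB (killCoord ℝ i))
    rw [killCoord_transpose] at this
    nlinarith [mul_nonneg hc this]

/-- Elementary symmetric functions are monotone for the Loewner order on positive semidefinite
matrices. -/
theorem esymmMatrix_mono (q : ℕ) {B P : Matrix (Fin p) (Fin p) ℝ} (hB : B.PosSemidef)
    (hP : P.PosSemidef) : esymmMatrix q B ≤ esymmMatrix q (B + P) := by
  obtain ⟨Q, hQ, hd⟩ := exists_orthogonal_diagonalization hP.1
  rw [← esymmMatrix_conj q hQ B, ← esymmMatrix_conj q hQ (B + P), Matrix.mul_add, Matrix.add_mul,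
    hd]
  replace hB := posSemidef_transpose_mul_mul hB Q
  generalize Qᵀ * B * Q = B at hB
  have key : ∀ s : Finset (Fin p), (B + ∑ i ∈ s, single i i (hP.1.eigenvalues i)).PosSemidef ∧
      esymmMatrix q B ≤ esymmMatrix q (B + ∑ i ∈ s, single i i (hP.1.eigenvalues i)) := by
    intro s
    induction s using Finset.induction_on with
    | empty => simpa using hB
    | insert i s hi ih =>
      rw [Finset.sum_insert hi, add_comm (single _ _ _), ← add_assoc]
      refine ⟨ih.1.add ?_, ih.2.trans (esymmMatrix_le_add_single q ih.1 i (hP.eigenvalues_nonneg i))⟩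
      rw [← diagonal_single]
      exact PosSemidef.diagonal (Pi.single_nonneg.2 (hP.eigenvalues_nonneg i))
  have := (key Finset.univ).2
  rwa [show ∑ i, single i i (hP.1.eigenvalues i) = diagonal hP.1.eigenvalues by
    ext j k
    simp [Matrix.sum_apply, single_apply, diagonal_apply, ite_and]] at this

end PosSemidef

/-- If `B₀` and `W` are even and odd for the reflection in the `i`-th coordinate, then
`t ↦ esymmMatrix q (B₀ + t W)` is an even polynomial, hence critical at `0`. -/
theorem hasDerivAt_esymmMatrix_of_reflection {p : ℕ} (q : ℕ) {S B₀ W : Matrix (Fin p) (Fin p) ℝ}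
    (hS : Sᵀ * S = 1) (hB₀ : Sᵀ * B₀ * S = B₀) (hW : Sᵀ * W * S = -W) :
    HasDerivAt (fun t : ℝ => esymmMatrix q (B₀ + t • W)) 0 0 := by
  have hpoly : (fun t : ℝ => esymmMatrix q (B₀ + t • W)) = fun t =>
      (esymmMatrix q (B₀.map Polynomial.C + (Polynomial.X : Polynomial ℝ) •
        W.map Polynomial.C)).eval t := by
    ext t
    rw [← Polynomial.coe_evalRingHom, ← esymmMatrix_map]
    congr 1
    ext j k : 1
    simp [mul_comm t]
  have hdiff : DifferentiableAt ℝ (fun t : ℝ => esymmMatrix q (B₀ + t • W)) 0 := by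
    rw [hpoly]
    exact Polynomial.differentiableAt _
  have heven : (fun t : ℝ => esymmMatrix q (B₀ + t • W)) =
      fun t => esymmMatrix q (B₀ + (-t) • W) := by
    ext t
    rw [← esymmMatrix_conj q hS (B₀ + t • W), Matrix.mul_add, Matrix.add_mul, hB₀,
      Matrix.mul_smul, Matrix.smul_mul, hW, smul_neg, neg_smul]
  have h := deriv_comp_neg (fun t : ℝ => esymmMatrix q (B₀ + t • W)) 0
  rw [← heven, neg_zero] at h
  have h0 : deriv (fun t : ℝ => esymmMatrix q (B₀ + t • W)) 0 = 0 := by linarith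
  simpa [h0] using hdiff.hasDerivAt

theorem mulVec_dotProduct_eq {k l : ℕ} (A : Matrix (Fin k) (Fin l) ℝ) (v : Fin l → ℝ)
    (w : Fin k → ℝ) : A *ᵥ v ⬝ᵥ w = v ⬝ᵥ Aᵀ *ᵥ w := by
  rw [dotProduct_mulVec, vecMul_transpose]

/-! ### Extremal compressions -/

section Loewner

variable {n p : ℕ}

theorem mul_orthogonal_mem_stiefel {X : Matrix (Fin n) (Fin p) ℝ} (hX : X ∈ stiefel n p)
    {Q : Matrix (Fin p) (Fin p) ℝ} (hQ : Qᵀ * Q = 1) : X * Q ∈ stiefel n p := by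
  rw [stiefel, Set.mem_ofPred_eq] at *
  rw [transpose_mul, Matrix.mul_assoc, ← Matrix.mul_assoc Xᵀ, hX, Matrix.one_mul, hQ]

theorem posSemidef_one_sub_mul_transpose {X : Matrix (Fin n) (Fin p) ℝ} (hX : X ∈ stiefel n p) :
    (1 - X * Xᵀ).PosSemidef := by
  have h : X * Xᵀ * (X * Xᵀ) = X * Xᵀ := by
    rw [Matrix.mul_assoc, ← Matrix.mul_assoc Xᵀ, hX, Matrix.one_mul]
  have h2 : (1 - X * Xᵀ) = (1 - X * Xᵀ)ᴴ * (1 - X * Xᵀ) := by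
    simp only [conjTranspose_eq_transpose_of_trivial, transpose_sub, transpose_one, transpose_mul,
      transpose_transpose, Matrix.mul_sub, Matrix.sub_mul, h]
    simp
  rw [h2]
  exact posSemidef_conjTranspose_mul_self _

/-- Compression of a matrix to the orthogonal complement of an invariant subspace. -/
theorem compression_eq {N : Matrix (Fin n) (Fin n) ℝ} {X : Matrix (Fin n) (Fin p) ℝ}
    (hX : X ∈ stiefel n p) {C : Matrix (Fin p) (Fin p) ℝ} (h₁ : N * X = X * C)
    (h₂ : Xᵀ * N = C * Xᵀ) : (1 - X * Xᵀ) * N * (1 - X * Xᵀ) = N - X * C * Xᵀ := by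
  have hX' : Xᵀ * X = 1 := hX
  have e₁ : N * (X * Xᵀ) = X * C * Xᵀ := by rw [← Matrix.mul_assoc, h₁]
  have e₂ : X * Xᵀ * N = X * C * Xᵀ := by rw [Matrix.mul_assoc, h₂, ← Matrix.mul_assoc]
  have e₃ : X * C * Xᵀ * (X * Xᵀ) = X * C * Xᵀ := by
    rw [Matrix.mul_assoc (X * C), ← Matrix.mul_assoc Xᵀ, hX', Matrix.one_mul]
  rw [Matrix.sub_mul, Matrix.one_mul, Matrix.mul_sub, Matrix.mul_one, e₂, Matrix.sub_mul, e₁, e₃]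
  abel

/-- A symmetric matrix that is nonnegative on the orthogonal complement of a frame has positive
semidefinite compression to that complement. -/
theorem compression_posSemidef {N : Matrix (Fin n) (Fin n) ℝ} {X : Matrix (Fin n) (Fin p) ℝ}
    (hX : X ∈ stiefel n p) (hN : Nᵀ = N) (h : ∀ y, Xᵀ *ᵥ y = 0 → 0 ≤ y ⬝ᵥ N *ᵥ y) :
    ((1 - X * Xᵀ) * N * (1 - X * Xᵀ)).PosSemidef := by
  have hX' : Xᵀ * X = 1 := hX
  have hP : (1 - X * Xᵀ)ᵀ = 1 - X * Xᵀ := by simp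
  refine PosSemidef.of_dotProduct_mulVec_nonneg ?_ fun v => ?_
  · rw [IsHermitian, conjTranspose_eq_transpose_of_trivial, transpose_mul, transpose_mul, hP, hN,
      Matrix.mul_assoc]
  · have h0 : Xᵀ *ᵥ ((1 - X * Xᵀ) *ᵥ v) = 0 := by
      rw [mulVec_mulVec, Matrix.mul_sub, ← Matrix.mul_assoc, hX', Matrix.mul_one, Matrix.one_mul,
        sub_self, zero_mulVec]
    have := h _ h0
    rwa [mulVec_dotProduct_eq, hP, mulVec_mulVec, mulVec_mulVec] at this

open scoped MatrixOrder in
theorem exists_symm_sqrt {D : Matrix (Fin p) (Fin p) ℝ} (hD : D.PosSemidef) :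
    ∃ R : Matrix (Fin p) (Fin p) ℝ, Rᵀ = R ∧ R * R = D :=
  ⟨CFC.sqrt D, transpose_eq_of_posSemidef (CFC.sqrt_nonneg D).posSemidef, CFC.sqrt_mul_sqrt_self D hD.nonneg⟩

/-- For orthonormal frames `X`, `Z` and symmetric `R`, the matrix `R Xᵀ Z Zᵀ X R` differs from
`R * R` by a positive semidefinite matrix. -/
theorem posSemidef_mul_self_sub {X Z : Matrix (Fin n) (Fin p) ℝ} (hX : X ∈ stiefel n p)
    (hZ : Z ∈ stiefel n p) {R : Matrix (Fin p) (Fin p) ℝ} (hR : Rᵀ = R) :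
    (R * R - (Zᵀ * X * R)ᵀ * (Zᵀ * X * R)).PosSemidef := by
  have h := posSemidef_transpose_mul_mul (posSemidef_one_sub_mul_transpose hZ) (X * R)
  have hX' : Xᵀ * X = 1 := hX
  convert h using 1
  rw [Matrix.mul_sub, Matrix.sub_mul, Matrix.mul_one]
  congr 1
  · rw [transpose_mul, hR, Matrix.mul_assoc, ← Matrix.mul_assoc Xᵀ, hX', Matrix.one_mul]
  · simp only [transpose_mul, transpose_transpose, Matrix.mul_assoc]

variable {M : Matrix (Fin n) (Fin n) ℝ} {X Z : Matrix (Fin n) (Fin p) ℝ}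
  {B : Matrix (Fin p) (Fin p) ℝ} {μ : ℝ}

theorem sub_smul_mul_eq (h : M * X = X * B) : (M - μ • 1) * X = X * (B - μ • 1) := by
  rw [Matrix.sub_mul, h, Matrix.mul_sub]
  simp

theorem transpose_mul_sub_smul_eq (hM : Mᵀ = M) (hB : Bᵀ = B) (h : M * X = X * B) :
    Xᵀ * (M - μ • 1) = (B - μ • 1) * Xᵀ := by
  have := congrArg transpose (sub_smul_mul_eq (μ := μ) h)
  simpa [transpose_mul, transpose_sub, hM, hB] using this

/-- If the range of `X` is an invariant subspace of `M` on which `M ≥ μ`, while `M ≤ μ` on the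
orthogonal complement, then `X` maximises the elementary symmetric functions of the compression of
`M`. -/
theorem esymmMatrix_compression_le (q : ℕ) (hM : M.PosSemidef) (hX : X ∈ stiefel n p)
    (hZ : Z ∈ stiefel n p) (hMX : M * X = X * B) (hμ : 0 ≤ μ) (hB : (B - μ • 1).PosSemidef)
    (hy : ∀ y, Xᵀ *ᵥ y = 0 → y ⬝ᵥ M *ᵥ y ≤ μ * (y ⬝ᵥ y)) :
    esymmMatrix q (Zᵀ * M * Z) ≤ esymmMatrix q B := by
  have hMt := transpose_eq_of_posSemidef hM
  have hZ' : Zᵀ * Z = 1 := hZ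
  have hBt : Bᵀ = B := by
    simpa using transpose_eq_of_posSemidef hB
  obtain ⟨R, hR, hRR⟩ := exists_symm_sqrt hB
  set W := Zᵀ * X * R
  have hT := compression_posSemidef (N := -(M - μ • 1)) hX (by simp [hMt]) (fun y h0 => by
    have := hy y h0
    simp only [neg_mulVec, sub_mulVec, smul_mulVec, one_mulVec, dotProduct_neg, dotProduct_sub,
      dotProduct_smul, smul_eq_mul]
    linarith)
  rw [Matrix.mul_neg, Matrix.neg_mul,
    compression_eq hX (sub_smul_mul_eq hMX) (transpose_mul_sub_smul_eq hMt hBt hMX)] at hT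
  have h₁ := esymmMatrix_mono q (posSemidef_transpose_mul_mul hM Z)
    (posSemidef_transpose_mul_mul hT Z)
  have e₁ : Zᵀ * M * Z + Zᵀ * -(M - μ • 1 - X * (B - μ • 1) * Xᵀ) * Z = μ • 1 + W * Wᵀ := by
    rw [← hRR, ← Matrix.add_mul, ← Matrix.mul_add]
    have : M + -(M - μ • 1 - X * (R * R) * Xᵀ) = μ • 1 + X * (R * R) * Xᵀ := by abel
    rw [this, Matrix.mul_add, Matrix.add_mul]
    congr 1
    · simp [hZ']
    · simp only [W, transpose_mul, hR, transpose_transpose, Matrix.mul_assoc]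
  rw [e₁, esymmMatrix_smul_one_add_mul_comm] at h₁
  have hμ1 : (μ • 1 : Matrix (Fin p) (Fin p) ℝ).PosSemidef := PosSemidef.one.smul hμ
  have h₂ := esymmMatrix_mono q (hμ1.add (by simpa using posSemidef_conjTranspose_mul_self W))
    (posSemidef_mul_self_sub hX hZ hR)
  rw [add_assoc, add_sub_cancel, hRR, add_sub_cancel] at h₂
  exact h₁.trans h₂

/-- If the range of `X` is an invariant subspace of `M` on which `M ≤ μ`, while `M ≥ μ` on the
orthogonal complement, then `X` minimises the elementary symmetric functions of the compression of
`M`. -/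
theorem le_esymmMatrix_compression (q : ℕ) (hM : M.PosSemidef) (hX : X ∈ stiefel n p)
    (hZ : Z ∈ stiefel n p) (hMX : M * X = X * B) (hμ : 0 ≤ μ) (hB0 : B.PosSemidef)
    (hB : (μ • 1 - B).PosSemidef)
    (hy : ∀ y, Xᵀ *ᵥ y = 0 → μ * (y ⬝ᵥ y) ≤ y ⬝ᵥ M *ᵥ y) :
    esymmMatrix q B ≤ esymmMatrix q (Zᵀ * M * Z) := by
  have hMt := transpose_eq_of_posSemidef hM
  have hZ' : Zᵀ * Z = 1 := hZ
  have hBt := transpose_eq_of_posSemidef hB0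
  obtain ⟨R, hR, hRR⟩ := exists_symm_sqrt hB
  set W := Zᵀ * X * R with hW
  have hT := compression_posSemidef (N := M - μ • 1) hX (by simp [hMt]) (fun y h0 => by
    have := hy y h0
    simp only [sub_mulVec, smul_mulVec, one_mulVec, dotProduct_sub, dotProduct_smul, smul_eq_mul]
    linarith)
  rw [compression_eq hX (sub_smul_mul_eq hMX) (transpose_mul_sub_smul_eq hMt hBt hMX)] at hT
  have e₀ : μ • 1 + X * (B - μ • 1) * Xᵀ = μ • (1 - X * Xᵀ) + X * B * Xᵀ := by
    simp only [Matrix.mul_sub, Matrix.sub_mul, smul_sub, Matrix.mul_smul, Matrix.smul_mul,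
      Matrix.mul_one]
    abel
  have hL : (μ • 1 + X * (B - μ • 1) * Xᵀ).PosSemidef := by
    rw [e₀]
    refine ((posSemidef_one_sub_mul_transpose hX).smul hμ).add ?_
    simpa using hB0.mul_mul_conjTranspose_same X
  have h₁ := esymmMatrix_mono q (posSemidef_transpose_mul_mul hL Z)
    (posSemidef_transpose_mul_mul hT Z)
  have e₁ : Zᵀ * (μ • 1 + X * (B - μ • 1) * Xᵀ) * Z = μ • 1 + W * (-Wᵀ) := by
    rw [← neg_sub (μ • 1) B, ← hRR, Matrix.mul_add, Matrix.add_mul]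
    congr 1
    · simp [hZ']
    · simp only [W, transpose_mul, hR, transpose_transpose, Matrix.mul_assoc, Matrix.mul_neg,
        Matrix.neg_mul]
  rw [← Matrix.add_mul, ← Matrix.mul_add, sub_sub, add_sub_cancel, e₁,
    esymmMatrix_smul_one_add_mul_comm] at h₁
  have h₂ := esymmMatrix_mono q hB0 (posSemidef_mul_self_sub hX hZ hR)
  have e₂ : B + (R * R - Wᵀ * W) = μ • 1 + (-Wᵀ) * W := by
    rw [hRR, Matrix.neg_mul]
    abel
  rw [← hW, e₂] at h₂
  exact h₂.trans h₁

end Loewner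

/-! ### Replacing one column of a frame -/

section ReplaceCol

variable {n p : ℕ}

/-- The frame `Z` with its `i`-th column `z` replaced by `α z + β y`. -/
def replaceCol (Z : Matrix (Fin n) (Fin p) ℝ) (i : Fin p) (y : Fin n → ℝ) (α β : ℝ) :
    Matrix (Fin n) (Fin p) ℝ :=
  Z.updateCol i (α • Zᵀ i + β • y)

theorem replaceCol_transpose_apply (Z : Matrix (Fin n) (Fin p) ℝ) (i : Fin p) (y : Fin n → ℝ)
    (α β : ℝ) (k : Fin p) :
    (replaceCol Z i y α β)ᵀ k = if k = i then α • Zᵀ i + β • y else Zᵀ k := by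
  ext j
  by_cases h : k = i
  · subst h; simp [replaceCol]
  · simp [replaceCol, h]

theorem replaceCol_one_zero (Z : Matrix (Fin n) (Fin p) ℝ) (i : Fin p) (y : Fin n → ℝ) :
    replaceCol Z i y 1 0 = Z := by
  ext j k
  by_cases h : k = i
  · subst h; simp [replaceCol]
  · simp [replaceCol, h]

theorem continuous_replaceCol (Z : Matrix (Fin n) (Fin p) ℝ) (i : Fin p) (y : Fin n → ℝ)
    {a b : ℝ → ℝ} (ha : Continuous a) (hb : Continuous b) :
    Continuous fun t => replaceCol Z i y (a t) (b t) := by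
  unfold replaceCol
  fun_prop

theorem transpose_mul_mul_apply (M : Matrix (Fin n) (Fin n) ℝ) (Y : Matrix (Fin n) (Fin p) ℝ)
    (k l : Fin p) : (Yᵀ * M * Y) k l = Yᵀ k ⬝ᵥ M *ᵥ Yᵀ l := by
  rw [Matrix.mul_assoc, Matrix.mul_apply']
  rfl

theorem dotProduct_mulVec_comm {M : Matrix (Fin n) (Fin n) ℝ} (hM : Mᵀ = M) (u v : Fin n → ℝ) :
    u ⬝ᵥ M *ᵥ v = v ⬝ᵥ M *ᵥ u := by
  rw [dotProduct_comm, mulVec_dotProduct_eq, hM]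

/-- The matrix whose only nonzero entries are `w k`, `k ≠ i`, in the `i`-th row and column. -/
def crossMatrix (i : Fin p) (w : Fin p → ℝ) : Matrix (Fin p) (Fin p) ℝ :=
  Matrix.of fun k l => if k = i then (if l = i then 0 else w l) else if l = i then w k else 0

theorem replaceCol_gram {M : Matrix (Fin n) (Fin n) ℝ} (hM : Mᵀ = M)
    {Z : Matrix (Fin n) (Fin p) ℝ} {d : Fin p → ℝ} (hd : Zᵀ * M * Z = diagonal d) (i : Fin p)
    (y : Fin n → ℝ) (α β : ℝ) :
    (replaceCol Z i y α β)ᵀ * M * replaceCol Z i y α β =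
      diagonal (Function.update d i 0) + β • crossMatrix i (fun k => Zᵀ k ⬝ᵥ M *ᵥ y) +
        single i i (α ^ 2 * d i + 2 * α * β * (Zᵀ i ⬝ᵥ M *ᵥ y) + β ^ 2 * (y ⬝ᵥ M *ᵥ y)) := by
  have h (k l : Fin p) : Zᵀ k ⬝ᵥ M *ᵥ Zᵀ l = diagonal d k l := by
    rw [← hd, transpose_mul_mul_apply]
  ext k l
  rw [transpose_mul_mul_apply, replaceCol_transpose_apply, replaceCol_transpose_apply]
  by_cases hk : k = i <;> by_cases hl : l = i
  · subst hk hl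
    simp [crossMatrix, mulVec_add, mulVec_smul, h, dotProduct_mulVec_comm hM y]
    ring
  · subst hk
    simp [crossMatrix, h, hl, Ne.symm hl, dotProduct_mulVec_comm hM y]
  · subst hl
    simp [crossMatrix, h, hk, Ne.symm hk, mulVec_add, mulVec_smul]
  · by_cases hkl : k = l
    · subst hkl
      simp [crossMatrix, h, hk, Ne.symm hk]
    · simp [crossMatrix, h, hk, hl, Ne.symm hk, hkl]

/-- Along a replacement of one column of a frame that diagonalises `M`, the elementary symmetric
function of the compression of `M` is affine in the changed diagonal entry, up to a term `g β` that
comes from the new off-diagonal entries and is critical at `β = 0`. -/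
theorem exists_esymmMatrix_replaceCol (q : ℕ) {M : Matrix (Fin n) (Fin n) ℝ} (hM : Mᵀ = M)
    {Z : Matrix (Fin n) (Fin p) ℝ} {d : Fin p → ℝ} (hd : Zᵀ * M * Z = diagonal d) (i : Fin p)
    (y : Fin n → ℝ) :
    ∃ g : ℝ → ℝ, HasDerivAt g 0 0 ∧ g 0 = esymmMatrix (q + 1) (diagonal (Function.update d i 0)) ∧
      ((∀ k, Zᵀ k ⬝ᵥ M *ᵥ y = 0) → ∀ β, g β = g 0) ∧
      ∀ α β, esymmMatrix (q + 1) ((replaceCol Z i y α β)ᵀ * M * replaceCol Z i y α β) =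
        g β + (α ^ 2 * d i + 2 * α * β * (Zᵀ i ⬝ᵥ M *ᵥ y) + β ^ 2 * (y ⬝ᵥ M *ᵥ y)) *
          esymmMatrix q (diagonal (Function.update d i 0)) := by
  refine ⟨fun β => esymmMatrix (q + 1) (diagonal (Function.update d i 0) +
    β • crossMatrix i (fun k => Zᵀ k ⬝ᵥ M *ᵥ y)), ?_, by simp, fun h β => ?_, fun α β => ?_⟩
  · refine hasDerivAt_esymmMatrix_of_reflection (q + 1)
      (S := diagonal fun j => if j = i then -1 else 1) ?_ ?_ ?_
    · rw [diagonal_transpose, diagonal_mul_diagonal, ← diagonal_one]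
      congr 1
      ext j
      split_ifs <;> simp
    · rw [diagonal_transpose, diagonal_mul_diagonal, diagonal_mul_diagonal]
      congr 1
      ext j
      by_cases h : j = i <;> simp [h]
    · rw [diagonal_transpose]
      ext k l
      rw [mul_diagonal, diagonal_mul]
      by_cases hk : k = i <;> by_cases hl : l = i <;> simp [crossMatrix, hk, hl]
  · have : crossMatrix i (fun k => Zᵀ k ⬝ᵥ M *ᵥ y) = 0 := by
      ext k l
      simp [crossMatrix, h]
    simp [this]
  · rw [replaceCol_gram hM hd, esymmMatrix_add_single]
    congr 3
    ext k l
    rw [killCoord_conj_apply]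
    by_cases hk : k = i <;> by_cases hl : l = i
    · subst hk hl; simp
    · subst hk; simp [Ne.symm hl]
    · subst hl; simp [hk]
    · simp [crossMatrix, hk, hl]

/-- Setting one entry of a nonnegative diagonal to zero destroys at most one nonzero factor, so the
elementary symmetric function of one degree less stays positive. -/
theorem esymmMatrix_update_pos {q : ℕ} {d : Fin p → ℝ} (hd : ∀ k, 0 ≤ d k)
    (h : 0 < esymmMatrix (q + 1) (diagonal d)) (i : Fin p) :
    0 < esymmMatrix q (diagonal (Function.update d i 0)) := by
  have hd' : ∀ k, 0 ≤ Function.update d i 0 k := fun k => by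
    by_cases hk : k = i
    · subst hk; simp
    · simp [hk, hd]
  rw [esymmMatrix_diagonal] at h ⊢
  obtain ⟨T, hT, hpos⟩ := Finset.exists_lt_of_sum_lt (f := fun _ => (0 : ℝ)) (by simpa using h)
  have hTc := (Finset.mem_powersetCard.1 hT).2
  have hle : q ≤ (T.erase i).card := by
    have := Finset.pred_card_le_card_erase (s := T) (a := i)
    omega
  obtain ⟨T', hT', hc⟩ := Finset.exists_subset_card_eq hle
  refine Finset.sum_pos' (fun S _ => Finset.prod_nonneg fun k _ => hd' k)
    ⟨T', Finset.mem_powersetCard.2 ⟨Finset.subset_univ _, hc⟩, Finset.prod_pos fun k hk => ?_⟩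
  have hk' := Finset.mem_erase.1 (hT' hk)
  rw [Function.update_of_ne hk'.1]
  exact (hd k).lt_of_ne' fun h0 => hpos.ne' (Finset.prod_eq_zero hk'.2 h0)

theorem stiefel_gram_diagonal {Z : Matrix (Fin n) (Fin p) ℝ} (hZ : Z ∈ stiefel n p) :
    Zᵀ * (1 : Matrix (Fin n) (Fin n) ℝ) * Z = diagonal fun _ => 1 := by
  rw [Matrix.mul_one, diagonal_one]
  exact hZ

/-- Replacing a column by a combination of it and a unit vector orthogonal to the frame changes the
Gram matrix only in one diagonal entry. -/
theorem replaceCol_gram_of_orthogonal {Z : Matrix (Fin n) (Fin p) ℝ} (hZ : Z ∈ stiefel n p)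
    (i : Fin p) {y : Fin n → ℝ} (hy : Zᵀ *ᵥ y = 0) (hy1 : y ⬝ᵥ y = 1) (α β : ℝ) :
    (replaceCol Z i y α β)ᵀ * replaceCol Z i y α β = 1 + single i i (α ^ 2 + β ^ 2 - 1) := by
  have h := replaceCol_gram transpose_one (stiefel_gram_diagonal hZ) i y α β
  have h0 (k : Fin p) : Zᵀ k ⬝ᵥ y = 0 := congrFun hy k
  simp only [Matrix.mul_one, one_mulVec, h0, hy1] at h
  rw [h]
  ext k l
  by_cases hk : k = i <;> by_cases hl : l = i
  · subst hk hl; simp [crossMatrix]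
  · subst hk; simp [crossMatrix, Ne.symm hl]
  · subst hl; simp [crossMatrix, hk, Ne.symm hk]
  · by_cases hkl : k = l
    · subst hkl; simp [crossMatrix, hk, Ne.symm hk]
    · simp [crossMatrix, Ne.symm hk, hkl]

theorem replaceCol_mem_stiefel {Z : Matrix (Fin n) (Fin p) ℝ} (hZ : Z ∈ stiefel n p)
    (i : Fin p) {y : Fin n → ℝ} (hy : Zᵀ *ᵥ y = 0) (hy1 : y ⬝ᵥ y = 1) {α β : ℝ}
    (h : α ^ 2 + β ^ 2 = 1) : replaceCol Z i y α β ∈ stiefel n p := by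
  rw [stiefel, Set.mem_ofPred_eq, replaceCol_gram_of_orthogonal hZ i hy hy1, h]
  simp

end ReplaceCol

/-! ### Invariance of the objective and of the Lagrangian -/

section Objective

variable {m n p : ℕ} (A : Matrix (Fin m) (Fin n) ℝ) (q : ℕ)

theorem inflation_eq (X : Matrix (Fin n) (Fin p) ℝ) :
    inflation A q X = esymmMatrix q (Xᵀ * (Aᵀ * A) * X) / esymmMatrix q (Xᵀ * X) := by
  rw [inflation, esymmEigenvalues_eq, esymmEigenvalues_eq, Matrix.mul_assoc Xᵀ]

theorem posSemidef_transpose_mul_self : (Aᵀ * A).PosSemidef := by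
  simpa using posSemidef_conjTranspose_mul_self A

theorem posSemidef_compression (X : Matrix (Fin n) (Fin p) ℝ) :
    (Xᵀ * (Aᵀ * A) * X).PosSemidef :=
  posSemidef_transpose_mul_mul (posSemidef_transpose_mul_self A) X

theorem esymmMatrix_one_pos {q : ℕ} (hqp : q ≤ p) :
    0 < esymmMatrix q (1 : Matrix (Fin p) (Fin p) ℝ) := by
  rw [esymmMatrix_pos_iff q PosSemidef.one]
  simpa using hqp

theorem inflation_eq_of_mem {X : Matrix (Fin n) (Fin p) ℝ} (hX : X ∈ stiefel n p) :
    inflation A q X =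
      esymmMatrix q (Xᵀ * (Aᵀ * A) * X) / esymmMatrix q (1 : Matrix (Fin p) (Fin p) ℝ) := by
  rw [inflation_eq, show Xᵀ * X = 1 from hX]

theorem inflation_nonneg (X : Matrix (Fin n) (Fin p) ℝ) : 0 ≤ inflation A q X := by
  rw [inflation_eq]
  exact div_nonneg (esymmMatrix_nonneg q (posSemidef_compression A X))
    (esymmMatrix_nonneg q (posSemidef_transpose_mul_self X))

theorem esymmMatrix_compression_pos_iff (X : Matrix (Fin n) (Fin p) ℝ) :
    0 < esymmMatrix q (Xᵀ * (Aᵀ * A) * X) ↔ q ≤ (A * X).rank := by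
  rw [esymmMatrix_pos_iff q (posSemidef_compression A X), ← rank_transpose_mul_self (A * X)]
  simp only [transpose_mul, Matrix.mul_assoc]

theorem inflation_pos_iff {q : ℕ} (hqp : q ≤ p) {X : Matrix (Fin n) (Fin p) ℝ}
    (hX : X ∈ stiefel n p) : 0 < inflation A q X ↔ q ≤ (A * X).rank := by
  rw [inflation_eq_of_mem A q hX, div_pos_iff_of_pos_right (esymmMatrix_one_pos hqp),
    esymmMatrix_compression_pos_iff]

theorem compression_mul (M : Matrix (Fin n) (Fin n) ℝ) (X : Matrix (Fin n) (Fin p) ℝ)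
    (Q : Matrix (Fin p) (Fin p) ℝ) : (X * Q)ᵀ * M * (X * Q) = Qᵀ * (Xᵀ * M * X) * Q := by
  simp only [transpose_mul, Matrix.mul_assoc]

variable {Q : Matrix (Fin p) (Fin p) ℝ}

theorem inflation_mul_orthogonal (hQ : Qᵀ * Q = 1) (X : Matrix (Fin n) (Fin p) ℝ) :
    inflation A q (X * Q) = inflation A q X := by
  have h : (X * Q)ᵀ * (X * Q) = Qᵀ * (Xᵀ * X) * Q := by
    simp only [transpose_mul, Matrix.mul_assoc]
  rw [inflation_eq, inflation_eq, compression_mul, h, esymmMatrix_conj q hQ, esymmMatrix_conj q hQ]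

theorem lagrangian_mul_orthogonal (hQ : Qᵀ * Q = 1) (Λ : Matrix (Fin p) (Fin p) ℝ)
    (X : Matrix (Fin n) (Fin p) ℝ) :
    lagrangian A q (Qᵀ * Λ * Q) (X * Q) = lagrangian A q Λ X := by
  have h : ((X * Q)ᵀ * (X * Q) - 1)ᵀ * (Qᵀ * Λ * Q) = Qᵀ * ((Xᵀ * X - 1)ᵀ * Λ * Q) := by
    have h1 : (X * Q)ᵀ * (X * Q) - 1 = Qᵀ * (Xᵀ * X - 1) * Q := by
      rw [Matrix.mul_sub, Matrix.sub_mul, Matrix.mul_one, hQ]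
      simp only [transpose_mul, Matrix.mul_assoc]
    rw [h1, transpose_mul, transpose_mul, transpose_transpose, Matrix.mul_assoc, Matrix.mul_assoc,
      ← Matrix.mul_assoc Q (Qᵀ * Λ), ← Matrix.mul_assoc Q Qᵀ, mul_transpose_eq_one hQ,
      Matrix.one_mul, Matrix.mul_assoc]
  rw [lagrangian, lagrangian, inflation_mul_orthogonal A q hQ, h, trace_mul_comm, Matrix.mul_assoc,
    mul_transpose_eq_one hQ, Matrix.mul_one]

theorem lagrangian_line_mul_orthogonal (hQ : Qᵀ * Q = 1) (Λ : Matrix (Fin p) (Fin p) ℝ)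
    (X Δ : Matrix (Fin n) (Fin p) ℝ) :
    (fun t : ℝ => lagrangian A q (Qᵀ * Λ * Q) (X * Q + t • (Δ * Q))) =
      fun t : ℝ => lagrangian A q Λ (X + t • Δ) := by
  ext t
  rw [← Matrix.smul_mul, ← Matrix.add_mul, lagrangian_mul_orthogonal A q hQ]

theorem mul_transpose_mul_cancel (hQ : Qᵀ * Q = 1) (X : Matrix (Fin n) (Fin p) ℝ) :
    X * Qᵀ * Q = X := by
  rw [Matrix.mul_assoc, hQ, Matrix.mul_one]

theorem mul_mul_transpose_cancel (hQ : Qᵀ * Q = 1) (X : Matrix (Fin n) (Fin p) ℝ) :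
    X * Q * Qᵀ = X := by
  rw [Matrix.mul_assoc, mul_transpose_eq_one hQ, Matrix.mul_one]

variable {A q}

theorem IsMultiplier.mul_orthogonal (hQ : Qᵀ * Q = 1) {X : Matrix (Fin n) (Fin p) ℝ}
    {Λ : Matrix (Fin p) (Fin p) ℝ} (h : IsMultiplier A q X Λ) :
    IsMultiplier A q (X * Q) (Qᵀ * Λ * Q) := by
  refine ⟨?_, fun Δ => ?_⟩
  · rw [IsSymm, transpose_mul, transpose_mul, transpose_transpose, h.1.eq, Matrix.mul_assoc]
  · rw [← mul_transpose_mul_cancel hQ Δ, lagrangian_line_mul_orthogonal A q hQ]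
    exact h.2 _

theorem mul_orthogonal_mem_tangentSpace {X Δ : Matrix (Fin n) (Fin p) ℝ}
    (h : Δ ∈ tangentSpace X) : Δ * Q ∈ tangentSpace (X * Q) := by
  rw [tangentSpace, Set.mem_ofPred_eq] at *
  have : (X * Q)ᵀ * (Δ * Q) + (Δ * Q)ᵀ * (X * Q) = Qᵀ * (Xᵀ * Δ + Δᵀ * X) * Q := by
    rw [Matrix.mul_add, Matrix.add_mul]
    simp only [transpose_mul, Matrix.mul_assoc]
  rw [this, h, Matrix.mul_zero, Matrix.zero_mul]

theorem hessian_mul_orthogonal (hQ : Qᵀ * Q = 1) (Λ : Matrix (Fin p) (Fin p) ℝ)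
    (X Δ : Matrix (Fin n) (Fin p) ℝ) :
    hessian A q (Qᵀ * Λ * Q) (X * Q) (Δ * Q) = hessian A q Λ X Δ := by
  rw [hessian, lagrangian_line_mul_orthogonal A q hQ, hessian]

theorem IsStrictSaddle.mul_orthogonal (hQ : Qᵀ * Q = 1) {X : Matrix (Fin n) (Fin p) ℝ}
    (h : IsStrictSaddle A q X) : IsStrictSaddle A q (X * Q) := by
  obtain ⟨hX, Λ, hΛ, ⟨Δ₁, hT₁, hΔ₁⟩, Δ₂, hT₂, hΔ₂⟩ := h
  refine ⟨mul_orthogonal_mem_stiefel hX hQ, _, hΛ.mul_orthogonal hQ,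
    ⟨Δ₁ * Q, mul_orthogonal_mem_tangentSpace hT₁, ?_⟩,
    Δ₂ * Q, mul_orthogonal_mem_tangentSpace hT₂, ?_⟩
  · rwa [hessian_mul_orthogonal hQ]
  · rwa [hessian_mul_orthogonal hQ]

theorem tendsto_mul_transpose_nhdsWithin (hQ : Qᵀ * Q = 1) (X : Matrix (Fin n) (Fin p) ℝ) :
    Filter.Tendsto (fun Y : Matrix (Fin n) (Fin p) ℝ => Y * Qᵀ)
      (nhdsWithin (X * Q) (stiefel n p)) (nhdsWithin X (stiefel n p)) := by
  have hc : Continuous fun Y : Matrix (Fin n) (Fin p) ℝ => Y * Qᵀ := by fun_prop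
  have h := hc.continuousWithinAt.tendsto_nhdsWithin (s := stiefel n p) (x := X * Q)
    (t := stiefel n p) fun Y hY => mul_orthogonal_mem_stiefel hY (Q := Qᵀ) (by
      rw [transpose_transpose]; exact mul_transpose_eq_one hQ)
  rwa [mul_mul_transpose_cancel hQ] at h

theorem inflation_mul_transpose (hQ : Qᵀ * Q = 1) (X : Matrix (Fin n) (Fin p) ℝ) :
    inflation A q (X * Qᵀ) = inflation A q X := by
  rw [← inflation_mul_orthogonal A q hQ, mul_transpose_mul_cancel hQ]

theorem isLocalMaxOn_mul_orthogonal (hQ : Qᵀ * Q = 1) {X : Matrix (Fin n) (Fin p) ℝ}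
    (h : IsLocalMaxOn (inflation A q) (stiefel n p) X) :
    IsLocalMaxOn (inflation A q) (stiefel n p) (X * Q) := by
  filter_upwards [(tendsto_mul_transpose_nhdsWithin hQ X).eventually h] with Y hY
  rwa [inflation_mul_transpose hQ, ← inflation_mul_orthogonal A q hQ X] at hY

theorem isLocalMinOn_mul_orthogonal (hQ : Qᵀ * Q = 1) {X : Matrix (Fin n) (Fin p) ℝ}
    (h : IsLocalMinOn (inflation A q) (stiefel n p) X) :
    IsLocalMinOn (inflation A q) (stiefel n p) (X * Q) := by
  filter_upwards [(tendsto_mul_transpose_nhdsWithin hQ X).eventually h] with Y hY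
  rwa [inflation_mul_transpose hQ, ← inflation_mul_orthogonal A q hQ X] at hY

end Objective

/-! ### Density of frames of large rank -/

section Density

variable {m n p : ℕ} {A : Matrix (Fin m) (Fin n) ℝ}

theorem exists_smul_dotProduct_self_eq_one {k : ℕ} {u : Fin k → ℝ} (hu : u ≠ 0) :
    ∃ c : ℝ, c ≠ 0 ∧ (c • u) ⬝ᵥ (c • u) = 1 := by
  have hpos : 0 < u ⬝ᵥ u := by simpa using dotProduct_star_self_pos_iff.2 hu
  refine ⟨(√(u ⬝ᵥ u))⁻¹, inv_ne_zero (Real.sqrt_pos.2 hpos).ne', ?_⟩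
  rw [smul_dotProduct, dotProduct_smul, smul_eq_mul, smul_eq_mul, ← mul_assoc, ← mul_inv,
    Real.mul_self_sqrt hpos.le, inv_mul_cancel₀ hpos.ne']

/-- If `A` loses rank on the range of `X`, some unit vector orthogonal to that range has its image
outside the range of `A X`. -/
theorem exists_orthogonal_unit_of_rank_lt {X : Matrix (Fin n) (Fin p) ℝ} (hX : X ∈ stiefel n p)
    (h : (A * X).rank < A.rank) :
    ∃ y : Fin n → ℝ, Xᵀ *ᵥ y = 0 ∧ y ⬝ᵥ y = 1 ∧ A *ᵥ y ∉ LinearMap.range (A * X).mulVecLin := by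
  have hX' : Xᵀ * X = 1 := hX
  by_contra! hcon
  refine h.not_ge (Submodule.finrank_mono ?_)
  rintro _ ⟨v, rfl⟩
  rw [mulVecLin_apply]
  have hv : A *ᵥ v = (A * X) *ᵥ (Xᵀ *ᵥ v) + A *ᵥ (v - X *ᵥ (Xᵀ *ᵥ v)) := by
    rw [mulVec_sub]
    simp only [mulVec_mulVec, Matrix.mul_assoc]
    abel
  rw [hv]
  refine Submodule.add_mem _ ⟨_, rfl⟩ ?_
  set z := v - X *ᵥ (Xᵀ *ᵥ v) with hz
  have hz0 : Xᵀ *ᵥ z = 0 := by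
    rw [hz, mulVec_sub, mulVec_mulVec, hX', one_mulVec, sub_self]
  by_cases hzz : z = 0
  · rw [hzz, mulVec_zero]
    exact Submodule.zero_mem _
  obtain ⟨c, hc, hc1⟩ := exists_smul_dotProduct_self_eq_one hzz
  have h2 := Submodule.smul_mem _ c⁻¹ (hcon (c • z) (by rw [mulVec_smul, hz0, smul_zero]) hc1)
  rwa [mulVec_smul, smul_smul, inv_mul_cancel₀ hc, one_smul] at h2

/-- The rank of `A X` is raised by rotating a column of `X` killed by `A` towards a vector whose image
lies outside the range of `A X`, through an arbitrarily small angle. -/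
theorem mem_closure_rank_gt {X : Matrix (Fin n) (Fin p) ℝ} (hX : X ∈ stiefel n p)
    (hp : (A * X).rank < p) (h : (A * X).rank < A.rank) :
    X ∈ closure {Y ∈ stiefel n p | (A * X).rank < (A * Y).rank} := by
  have hB := (posSemidef_compression A X).1
  obtain ⟨Q, hQ, hd⟩ := exists_orthogonal_diagonalization hB
  set d := hB.eigenvalues
  have hQu : IsUnit Q.det := (isUnit_iff_isUnit_det Q).1 (IsUnit.of_mul_eq_one _ (mul_transpose_eq_one hQ))
  have hZ := mul_orthogonal_mem_stiefel hX hQ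
  have hrank (Y : Matrix (Fin n) (Fin p) ℝ) : (A * (Y * Q)).rank = (A * Y).rank := by
    rw [← Matrix.mul_assoc, rank_mul_eq_left_of_isUnit_det _ _ hQu]
  rw [← compression_mul] at hd
  rw [← hrank] at h hp
  have hcl : X * Q ∈ closure {Y ∈ stiefel n p | (A * (X * Q)).rank < (A * Y).rank} := by
    generalize X * Q = Z at *
    obtain ⟨y, hy, hy1, hAy⟩ := exists_orthogonal_unit_of_rank_lt hZ h
    -- fewer than `p` nonzero eigenvalues, so one column of `Z` is killed by `A`
    obtain ⟨i, hi⟩ : ∃ i, d i = 0 := by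
      by_contra! hcon
      have h1 : (A * Z).rank = (diagonal d).rank := by
        rw [← hd, ← rank_transpose_mul_self (A * Z)]
        simp only [transpose_mul, Matrix.mul_assoc]
      rw [h1, rank_diagonal] at hp
      simp [hcon] at hp
    have hAz : A *ᵥ Zᵀ i = 0 := by
      have h1 : Zᵀ i ⬝ᵥ (Aᵀ * A) *ᵥ Zᵀ i = 0 := by
        rw [← transpose_mul_mul_apply, hd, diagonal_apply_eq, hi]
      rw [← mulVec_mulVec, ← mulVec_dotProduct_eq] at h1
      exact dotProduct_self_eq_zero.1 h1
    have hAz' (l : Fin m) : ∑ j, A l j * Z j i = 0 := congrFun hAz l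
    have hcont : Continuous fun t : ℝ => replaceCol Z i y (Real.cos t) (Real.sin t) :=
      continuous_replaceCol Z i y Real.continuous_cos Real.continuous_sin
    have hten : Filter.Tendsto (fun t : ℝ => replaceCol Z i y (Real.cos t) (Real.sin t))
        (nhdsWithin 0 (Set.Ioi 0)) (nhds Z) := by
      have := (hcont.tendsto 0).mono_left (nhdsWithin_le_nhds (s := Set.Ioi 0))
      simpa [replaceCol_one_zero] using this
    refine mem_closure_of_tendsto hten ?_
    filter_upwards [Ioo_mem_nhdsGT Real.pi_pos] with t ht
    have hs : Real.sin t ≠ 0 := (Real.sin_pos_of_pos_of_lt_pi ht.1 ht.2).ne'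
    refine ⟨replaceCol_mem_stiefel hZ i hy hy1 (Real.cos_sq_add_sin_sq t), ?_⟩
    set Y := replaceCol Z i y (Real.cos t) (Real.sin t)
    have hcol (k : Fin p) : (A * Y)ᵀ k = A *ᵥ Yᵀ k := rfl
    have hcolZ (k : Fin p) : (A * Z)ᵀ k = A *ᵥ Zᵀ k := rfl
    have hspan (k : Fin p) : (A * Y)ᵀ k ∈ LinearMap.range (A * Y).mulVecLin := by
      rw [range_mulVecLin]
      exact Submodule.subset_span ⟨k, rfl⟩
    have hle : LinearMap.range (A * Z).mulVecLin ≤ LinearMap.range (A * Y).mulVecLin := by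
      rw [range_mulVecLin (A * Z), Submodule.span_le]
      rintro _ ⟨k, rfl⟩
      change (A * Z)ᵀ k ∈ LinearMap.range (A * Y).mulVecLin
      by_cases hk : k = i
      · rw [hcolZ, hk, hAz]
        exact Submodule.zero_mem _
      · have := hspan k
        rwa [hcol, replaceCol_transpose_apply, if_neg hk] at this
    refine Submodule.finrank_lt_finrank_of_lt (lt_of_le_of_ne hle fun heq => hAy ?_)
    rw [heq]
    have := hspan i
    rw [hcol, replaceCol_transpose_apply, if_pos rfl, mulVec_add, mulVec_smul, hAz, smul_zero,
      zero_add, mulVec_smul] at this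
    have h2 := Submodule.smul_mem _ (Real.sin t)⁻¹ this
    rwa [smul_smul, inv_mul_cancel₀ hs, one_smul] at h2
  have hc : Continuous fun Y : Matrix (Fin n) (Fin p) ℝ => Y * Qᵀ := by fun_prop
  have := mem_closure_image hc.continuousAt hcl
  rw [mul_mul_transpose_cancel hQ] at this
  refine closure_mono ?_ this
  rintro _ ⟨Y, ⟨hY, hYr⟩, rfl⟩
  have hQt : Qᵀᵀ * Qᵀ = 1 := by rw [transpose_transpose]; exact mul_transpose_eq_one hQ
  refine ⟨mul_orthogonal_mem_stiefel hY hQt, ?_⟩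
  rw [← hrank X, ← hrank (Y * Qᵀ), mul_transpose_mul_cancel hQ]
  exact hYr

/-- Frames on which `A` has rank at least `q` are dense in the Stiefel manifold. -/
theorem stiefel_subset_closure_rank_ge {q : ℕ} (hqp : q ≤ p) (hq : q ≤ A.rank) :
    stiefel n p ⊆ closure {Y ∈ stiefel n p | q ≤ (A * Y).rank} := by
  induction q with
  | zero => exact fun X hX => subset_closure ⟨hX, Nat.zero_le _⟩
  | succ k ih =>
    refine (ih (by omega) (by omega)).trans (closure_minimal ?_ isClosed_closure)
    rintro X ⟨hX, hk⟩
    by_cases hk' : k + 1 ≤ (A * X).rank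
    · exact subset_closure ⟨hX, hk'⟩
    · refine closure_mono ?_ (mem_closure_rank_gt (A := A) (X := X) hX (by omega) (by omega))
      exact fun Y hY => ⟨hY.1, hk.trans_lt hY.2⟩

/-- At a local maximiser the objective is positive as soon as it is positive somewhere. -/
theorem inflation_pos_of_isLocalMaxOn {q : ℕ} (hqp : q ≤ p) (hq : q ≤ A.rank)
    {X : Matrix (Fin n) (Fin p) ℝ} (hX : X ∈ stiefel n p)
    (h : IsLocalMaxOn (inflation A q) (stiefel n p) X) : 0 < inflation A q X := by
  have hcl := stiefel_subset_closure_rank_ge hqp hq hX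
  rw [IsLocalMaxOn, IsMaxFilter, eventually_nhdsWithin_iff] at h
  obtain ⟨Y, ⟨hY, hYr⟩, hYX⟩ := ((mem_closure_iff_frequently.1 hcl).and_eventually h).exists
  exact ((inflation_pos_iff A hqp hY).2 hYr).trans_le (hYX hY)

end Density

/-! ### Derivatives along one-parameter families -/

section Calculus

variable {g : ℝ → ℝ} (d w ν h : ℝ)

theorem hasDerivAt_rotation (hg : HasDerivAt g 0 0) (D : ℝ) :
    HasDerivAt (fun t : ℝ => (g (Real.sin t) + (Real.cos t ^ 2 * d +
      2 * Real.cos t * Real.sin t * w + Real.sin t ^ 2 * ν) * h) / D) (2 * w * h / D) 0 := by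
  have hgs : HasDerivAt (fun t => g (Real.sin t)) 0 0 := by
    have h1 : HasDerivAt g 0 (Real.sin 0) := by simpa using hg
    exact (h1.comp 0 (Real.hasDerivAt_sin 0)).congr_deriv (by simp)
  have hc := Real.hasDerivAt_cos 0
  have hs := Real.hasDerivAt_sin 0
  refine ((hgs.fun_add (((((hc.fun_pow 2).mul_const d).fun_add
    (((hc.const_mul 2).fun_mul hs).mul_const w)).fun_add
      ((hs.fun_pow 2).mul_const ν)).mul_const h)).div_const D).congr_deriv ?_
  simp

theorem hasDerivAt_line (hg : HasDerivAt g 0 0) (ℓ : ℝ) {c e : ℝ} (hne : c + e ≠ 0) :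
    HasDerivAt (fun t : ℝ => (g t + (1 ^ 2 * d + 2 * 1 * t * w + t ^ 2 * ν) * h) /
      (c + (1 ^ 2 + t ^ 2) * e) + (1 ^ 2 + t ^ 2 - 1) * ℓ) (2 * w * h / (c + e)) 0 := by
  have hid := hasDerivAt_id' (0 : ℝ)
  have hsq := hid.fun_pow 2
  refine (((hg.fun_add (((((hid.const_mul (2 * 1)).mul_const w).const_add (1 ^ 2 * d)).fun_add
    (hsq.mul_const ν)).mul_const h)).fun_div
      (((hsq.const_add (1 ^ 2)).mul_const e).const_add c) (by simpa using hne)).fun_add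
        (((hsq.const_add (1 ^ 2)).sub_const 1).mul_const ℓ)).congr_deriv ?_
  simp
  field_simp

/-- The derivative of the Lagrangian when one column of the frame is scaled by `1 + t`. The zero terms
are kept so that the function is literally the one obtained by substituting `β = 0`. -/
theorem hasDerivAt_scaling (a d ν h ℓ : ℝ) {c e : ℝ} (hne : c + e ≠ 0) :
    HasDerivAt (fun t : ℝ => (a + ((1 + t) ^ 2 * d + 2 * (1 + t) * 0 * 0 + 0 ^ 2 * ν) * h) /
      (c + ((1 + t) ^ 2 + 0 ^ 2) * e) + ((1 + t) ^ 2 + 0 ^ 2 - 1) * ℓ)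
      ((2 * (d * h) * (c + e) - (a + d * h) * (2 * e)) / (c + e) ^ 2 + 2 * ℓ) 0 := by
  have hsq := ((hasDerivAt_id' (0 : ℝ)).const_add 1).fun_pow 2
  simp only [mul_zero, zero_mul, add_zero, ne_eq, OfNat.ofNat_ne_zero, not_false_eq_true, zero_pow]
  refine ((((((hsq.mul_const d).mul_const h).const_add a).fun_div ((hsq.mul_const e).const_add c)
    (by simpa using hne)).fun_add ((hsq.sub_const 1).mul_const ℓ))).congr_deriv ?_
  simp [mul_assoc]

theorem iteratedDeriv_two_quadratic_quotient (a b ℓ : ℝ) {c e : ℝ} (hc : 0 < c) (he : 0 ≤ e) :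
    iteratedDeriv 2 (fun t : ℝ => (a + b * t ^ 2) / (c + e * t ^ 2) + ℓ * t ^ 2) 0 =
      2 * (b * c - a * e) / c ^ 2 + 2 * ℓ := by
  have hpos (t : ℝ) : c + e * t ^ 2 ≠ 0 := by positivity
  have hsq (t : ℝ) : HasDerivAt (fun t : ℝ => t ^ 2) (2 * t) t := by
    simpa using hasDerivAt_pow 2 t
  have hderiv : deriv (fun t : ℝ => (a + b * t ^ 2) / (c + e * t ^ 2) + ℓ * t ^ 2) =
      fun t => t * (2 * (b * c - a * e) / (c + e * t ^ 2) ^ 2 + 2 * ℓ) := by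
    ext t
    rw [((((hsq t).const_mul b |>.const_add a).fun_div ((hsq t).const_mul e |>.const_add c)
      (hpos t)).fun_add ((hsq t).const_mul ℓ)).deriv]
    have := hpos t
    field_simp
    ring
  rw [iteratedDeriv_succ, iteratedDeriv_one, hderiv]
  have hG : DifferentiableAt ℝ
      (fun t : ℝ => 2 * (b * c - a * e) / (c + e * t ^ 2) ^ 2 + 2 * ℓ) 0 := by
    have h2 : (c + e * (0 : ℝ) ^ 2) ^ 2 ≠ 0 := pow_ne_zero 2 (hpos 0)
    fun_prop (disch := exact h2)
  have := ((hasDerivAt_id' (0 : ℝ)).fun_mul hG.hasDerivAt).deriv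
  simpa using this

end Calculus

/-! ### First- and second-order conditions -/

section Critical

variable {m n p q : ℕ} {A : Matrix (Fin m) (Fin n) ℝ} {Z : Matrix (Fin n) (Fin p) ℝ}
  {d : Fin p → ℝ}

/-- The objective along the replacement of one column of a diagonalising frame by a combination
with an orthogonal unit vector. -/
theorem exists_inflation_replaceCol (hq : q + 1 ≤ p) (hZ : Z ∈ stiefel n p)
    (hd : Zᵀ * (Aᵀ * A) * Z = diagonal d) (hpos : 0 < inflation A (q + 1) Z) (i : Fin p)
    {y : Fin n → ℝ} (hy : Zᵀ *ᵥ y = 0) (hy1 : y ⬝ᵥ y = 1) :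
    ∃ (g : ℝ → ℝ) (h c e : ℝ), HasDerivAt g 0 0 ∧
      ((∀ k, Zᵀ k ⬝ᵥ (Aᵀ * A) *ᵥ y = 0) → ∀ β, g β = g 0) ∧ 0 < h ∧ 0 ≤ c ∧ 0 < e ∧
      ∀ α β, inflation A (q + 1) (replaceCol Z i y α β) =
        (g β + (α ^ 2 * d i + 2 * α * β * (Zᵀ i ⬝ᵥ (Aᵀ * A) *ᵥ y) +
          β ^ 2 * (y ⬝ᵥ (Aᵀ * A) *ᵥ y)) * h) / (c + (α ^ 2 + β ^ 2) * e) := by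
  have hM := posSemidef_transpose_mul_self A
  obtain ⟨g, hg, -, hg', hN⟩ :=
    exists_esymmMatrix_replaceCol q (transpose_eq_of_posSemidef hM) hd i y
  obtain ⟨g₁, -, hg₁, hg₁', hD⟩ :=
    exists_esymmMatrix_replaceCol q transpose_one (stiefel_gram_diagonal hZ) i y
  have h0 (k : Fin p) : Zᵀ k ⬝ᵥ y = 0 := congrFun hy k
  simp only [one_mulVec, h0, hy1, Matrix.mul_one, implies_true, forall_const] at hg₁' hD
  have hd0 : ∀ k, 0 ≤ d k := by
    have := posSemidef_compression A Z
    rw [hd] at this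
    exact posSemidef_diagonal_iff.1 this
  have hdpos : 0 < esymmMatrix (q + 1) (diagonal d) := by
    rwa [inflation_eq_of_mem A _ hZ, div_pos_iff_of_pos_right (esymmMatrix_one_pos hq), hd] at hpos
  have h1pos : 0 < esymmMatrix (q + 1) (diagonal fun _ : Fin p => (1 : ℝ)) := by
    rw [diagonal_one]
    exact esymmMatrix_one_pos hq
  refine ⟨g, _, g₁ 0, _, hg, hg', esymmMatrix_update_pos hd0 hdpos i, ?_,
    esymmMatrix_update_pos (fun _ => zero_le_one) h1pos i, fun α β => ?_⟩
  · rw [hg₁]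
    refine esymmMatrix_nonneg _ (PosSemidef.diagonal fun k => ?_)
    by_cases hk : k = i
    · subst hk; simp
    · simp [hk]
  · rw [inflation_eq, hN, hD, hg₁']
    ring

/-- Rotating one column towards an orthogonal unit vector is a continuous curve in the Stiefel
manifold. -/
theorem tendsto_replaceCol_rotation (hZ : Z ∈ stiefel n p) (i : Fin p) {y : Fin n → ℝ}
    (hy : Zᵀ *ᵥ y = 0) (hy1 : y ⬝ᵥ y = 1) :
    Filter.Tendsto (fun t : ℝ => replaceCol Z i y (Real.cos t) (Real.sin t)) (nhds 0)
      (nhdsWithin Z (stiefel n p)) := by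
  refine tendsto_nhdsWithin_iff.2 ⟨?_, Filter.Eventually.of_forall fun t =>
    replaceCol_mem_stiefel hZ i hy hy1 (Real.cos_sq_add_sin_sq t)⟩
  have := (continuous_replaceCol Z i y Real.continuous_cos Real.continuous_sin).tendsto 0
  simpa [replaceCol_one_zero] using this

/-- First-order condition at a local extremum, along the rotation of one column of `Z` towards
`y`. -/
theorem cross_eq_zero_of_isLocalExtrOn (hq : q + 1 ≤ p) (hZ : Z ∈ stiefel n p)
    (hd : Zᵀ * (Aᵀ * A) * Z = diagonal d) (hpos : 0 < inflation A (q + 1) Z)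
    (hext : IsLocalExtrOn (inflation A (q + 1)) (stiefel n p) Z) (i : Fin p)
    {y : Fin n → ℝ} (hy : Zᵀ *ᵥ y = 0) (hy1 : y ⬝ᵥ y = 1) :
    Zᵀ i ⬝ᵥ (Aᵀ * A) *ᵥ y = 0 := by
  obtain ⟨g, h, c, e, hg, -, hh, hc, he, hf⟩ := exists_inflation_replaceCol hq hZ hd hpos i hy hy1
  set w := Zᵀ i ⬝ᵥ (Aᵀ * A) *ᵥ y
  set ν := y ⬝ᵥ (Aᵀ * A) *ᵥ y
  have hcurve : IsLocalExtr
      (fun t : ℝ => inflation A (q + 1) (replaceCol Z i y (Real.cos t) (Real.sin t))) 0 := by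
    have hZ0 : replaceCol Z i y (Real.cos 0) (Real.sin 0) = Z := by simp [replaceCol_one_zero]
    have hten := tendsto_replaceCol_rotation hZ i hy hy1
    refine hext.imp (fun hmin => ?_) (fun hmax => ?_)
    · filter_upwards [hten.eventually hmin] with t ht
      rwa [hZ0]
    · filter_upwards [hten.eventually hmax] with t ht
      rwa [hZ0]
  simp only [hf, Real.cos_sq_add_sin_sq] at hcurve
  have h0 := hcurve.hasDerivAt_eq_zero (hasDerivAt_rotation (d i) w ν h hg (c + 1 * e))
  have hne : c + e ≠ 0 := by positivity
  simpa [hne, hh.ne'] using h0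

theorem replaceCol_one_eq (Z : Matrix (Fin n) (Fin p) ℝ) (i : Fin p) (y : Fin n → ℝ) (t : ℝ) :
    Z + t • vecMulVec y (Pi.single i 1) = replaceCol Z i y 1 t := by
  ext j k
  by_cases h : k = i
  · subst h; simp [replaceCol, vecMulVec_apply]
  · simp [replaceCol, vecMulVec_apply, h]

theorem replaceCol_one_add_eq (Z : Matrix (Fin n) (Fin p) ℝ) (i : Fin p) (y : Fin n → ℝ) (t : ℝ) :
    Z + t • vecMulVec (Zᵀ i) (Pi.single i 1) = replaceCol Z i y (1 + t) 0 := by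
  ext j k
  by_cases h : k = i
  · subst h
    simp [replaceCol, vecMulVec_apply]
    ring
  · simp [replaceCol, vecMulVec_apply, h]

theorem lagrangian_replaceCol (hZ : Z ∈ stiefel n p) (Λ : Matrix (Fin p) (Fin p) ℝ) (i : Fin p)
    {y : Fin n → ℝ} (hy : Zᵀ *ᵥ y = 0) (hy1 : y ⬝ᵥ y = 1) (α β : ℝ) :
    lagrangian A q Λ (replaceCol Z i y α β) =
      inflation A q (replaceCol Z i y α β) + (α ^ 2 + β ^ 2 - 1) * Λ i i := by
  rw [lagrangian, replaceCol_gram_of_orthogonal hZ i hy hy1, add_sub_cancel_left, transpose_single,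
    trace_single_mul, smul_eq_mul]

/-- First-order condition at a stationary point, along the line moving one column of `Z` towards
`y`. -/
theorem cross_eq_zero_of_isMultiplier (hq : q + 1 ≤ p) (hZ : Z ∈ stiefel n p)
    (hd : Zᵀ * (Aᵀ * A) * Z = diagonal d) (hpos : 0 < inflation A (q + 1) Z)
    {Λ : Matrix (Fin p) (Fin p) ℝ} (hΛ : IsMultiplier A (q + 1) Z Λ) (i : Fin p)
    {y : Fin n → ℝ} (hy : Zᵀ *ᵥ y = 0) (hy1 : y ⬝ᵥ y = 1) :
    Zᵀ i ⬝ᵥ (Aᵀ * A) *ᵥ y = 0 := by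
  obtain ⟨g, h, c, e, hg, -, hh, hc, he, hf⟩ := exists_inflation_replaceCol hq hZ hd hpos i hy hy1
  set w := Zᵀ i ⬝ᵥ (Aᵀ * A) *ᵥ y
  set ν := y ⬝ᵥ (Aᵀ * A) *ᵥ y
  have h0 := hΛ.2 (vecMulVec y (Pi.single i 1))
  simp only [replaceCol_one_eq, lagrangian_replaceCol hZ Λ i hy hy1, hf] at h0
  have hne : c + e ≠ 0 := by positivity
  rw [(hasDerivAt_line (d i) w ν h hg (Λ i i) hne).deriv] at h0
  simpa [hne, hh.ne'] using h0

/-- If all cross terms with vectors orthogonal to the frame vanish, the range of the frame is invariant: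
test with `y` proportional to the component of `M z` orthogonal to the frame. -/
theorem mul_eq_of_cross_eq_zero {M : Matrix (Fin n) (Fin n) ℝ} (hM : Mᵀ = M)
    (hZ : Z ∈ stiefel n p) (hd : Zᵀ * M * Z = diagonal d)
    (h : ∀ i, ∀ y, Zᵀ *ᵥ y = 0 → y ⬝ᵥ y = 1 → Zᵀ i ⬝ᵥ M *ᵥ y = 0) : M * Z = Z * diagonal d := by
  have hZ' : Zᵀ * Z = 1 := hZ
  rw [← hd]
  ext j i
  suffices hu : M *ᵥ Zᵀ i - Z *ᵥ (Zᵀ *ᵥ (M *ᵥ Zᵀ i)) = 0 by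
    have e₂ : Z * (Zᵀ * M * Z) = Z * Zᵀ * M * Z := by simp only [Matrix.mul_assoc]
    rw [mulVec_mulVec, mulVec_mulVec] at hu
    rw [e₂]
    exact sub_eq_zero.1 (congrFun hu j)
  by_contra hu
  obtain ⟨c, hc, hc1⟩ := exists_smul_dotProduct_self_eq_one hu
  set u := M *ᵥ Zᵀ i - Z *ᵥ (Zᵀ *ᵥ (M *ᵥ Zᵀ i)) with hu_def
  have hZu : Zᵀ *ᵥ u = 0 := by
    rw [hu_def, mulVec_sub, mulVec_mulVec _ Zᵀ Z, hZ', one_mulVec, sub_self]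
  have h1 := h i (c • u) (by rw [mulVec_smul, hZu, smul_zero]) hc1
  have huu : u ⬝ᵥ u = 0 := by
    rw [mulVec_smul, dotProduct_smul, dotProduct_mulVec_comm hM, smul_eq_mul] at h1
    have h2 := (mul_eq_zero.1 h1).resolve_left hc
    have h3 : u ⬝ᵥ Z *ᵥ (Zᵀ *ᵥ (M *ᵥ Zᵀ i)) = 0 := by
      rw [dotProduct_comm, mulVec_dotProduct_eq, hZu, dotProduct_zero]
    conv_lhs => rw [hu_def]
    rw [sub_dotProduct, dotProduct_comm, h2, dotProduct_comm, h3, sub_zero]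
  exact hu (dotProduct_self_eq_zero.1 huu)

theorem cross_eq_zero_of_mul_eq {M : Matrix (Fin n) (Fin n) ℝ} (hM : Mᵀ = M)
    (h : M * Z = Z * diagonal d) {y : Fin n → ℝ} (hy : Zᵀ *ᵥ y = 0) (k : Fin p) :
    Zᵀ k ⬝ᵥ M *ᵥ y = 0 := by
  have h1 : Zᵀ * M = diagonal d * Zᵀ := by
    have := congrArg transpose h
    rwa [transpose_mul, transpose_mul, hM, diagonal_transpose] at this
  have h2 : (Zᵀ * M) *ᵥ y = 0 := by rw [h1, ← mulVec_mulVec, hy, mulVec_zero]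
  rw [← mulVec_mulVec] at h2
  exact congrFun h2 k

/-- Second-order condition: rotating one column of an invariant frame towards `y` changes the
objective by a positive multiple of `y · M y - dᵢ`. -/
theorem exists_inflation_rotation (hq : q + 1 ≤ p) (hZ : Z ∈ stiefel n p)
    (hd : Zᵀ * (Aᵀ * A) * Z = diagonal d) (hpos : 0 < inflation A (q + 1) Z)
    (hinv : Aᵀ * A * Z = Z * diagonal d) (i : Fin p)
    {y : Fin n → ℝ} (hy : Zᵀ *ᵥ y = 0) (hy1 : y ⬝ᵥ y = 1) :
    ∃ κ : ℝ, 0 < κ ∧ ∀ t, inflation A (q + 1) (replaceCol Z i y (Real.cos t) (Real.sin t)) =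
      inflation A (q + 1) Z + Real.sin t ^ 2 * (κ * (y ⬝ᵥ (Aᵀ * A) *ᵥ y - d i)) := by
  have hM := transpose_eq_of_posSemidef (posSemidef_transpose_mul_self A)
  obtain ⟨g, h, c, e, -, hg, hh, hc, he, hf⟩ := exists_inflation_replaceCol hq hZ hd hpos i hy hy1
  have hcross := cross_eq_zero_of_mul_eq hM hinv hy
  have hZf := hf 1 0
  rw [replaceCol_one_zero] at hZf
  refine ⟨h / (c + e), by positivity, fun t => ?_⟩
  rw [hZf, hf, hg hcross, hcross, Real.cos_sq_add_sin_sq, Real.cos_sq']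
  have hne : c + e ≠ 0 := by positivity
  simp only [one_pow, one_mul, mul_one, mul_zero, add_zero, ne_eq, OfNat.ofNat_ne_zero,
    not_false_eq_true, zero_pow, zero_mul]
  field_simp
  ring

theorem exists_sin_sq_pos_of_eventually {P : ℝ → Prop} (h : ∀ᶠ t in nhds 0, P t) :
    ∃ t, 0 < Real.sin t ^ 2 ∧ P t := by
  have h1 : ∀ᶠ t in nhdsWithin (0 : ℝ) (Set.Ioi 0), P t := h.filter_mono nhdsWithin_le_nhds
  obtain ⟨t, ht, hP⟩ := (h1.and (Ioo_mem_nhdsGT Real.pi_pos)).exists.imp fun t ht => ht.symm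
  exact ⟨t, pow_pos (Real.sin_pos_of_pos_of_lt_pi ht.1 ht.2) 2, hP⟩

/-- Second-order necessary condition for a local maximiser. -/
theorem quadForm_le_of_isLocalMaxOn (hq : q + 1 ≤ p) (hZ : Z ∈ stiefel n p)
    (hd : Zᵀ * (Aᵀ * A) * Z = diagonal d) (hpos : 0 < inflation A (q + 1) Z)
    (hinv : Aᵀ * A * Z = Z * diagonal d)
    (hmax : IsLocalMaxOn (inflation A (q + 1)) (stiefel n p) Z) (i : Fin p)
    {y : Fin n → ℝ} (hy : Zᵀ *ᵥ y = 0) (hy1 : y ⬝ᵥ y = 1) : y ⬝ᵥ (Aᵀ * A) *ᵥ y ≤ d i := by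
  obtain ⟨κ, hκ, hf⟩ := exists_inflation_rotation hq hZ hd hpos hinv i hy hy1
  obtain ⟨t, ht, hle⟩ := exists_sin_sq_pos_of_eventually
    ((tendsto_replaceCol_rotation hZ i hy hy1).eventually hmax)
  rw [hf t, add_le_iff_nonpos_right] at hle
  have := nonpos_of_mul_nonpos_right (nonpos_of_mul_nonpos_right hle ht) hκ
  linarith

/-- Second-order necessary condition for a local minimiser. -/
theorem le_quadForm_of_isLocalMinOn (hq : q + 1 ≤ p) (hZ : Z ∈ stiefel n p)
    (hd : Zᵀ * (Aᵀ * A) * Z = diagonal d) (hpos : 0 < inflation A (q + 1) Z)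
    (hinv : Aᵀ * A * Z = Z * diagonal d)
    (hmin : IsLocalMinOn (inflation A (q + 1)) (stiefel n p) Z) (i : Fin p)
    {y : Fin n → ℝ} (hy : Zᵀ *ᵥ y = 0) (hy1 : y ⬝ᵥ y = 1) : d i ≤ y ⬝ᵥ (Aᵀ * A) *ᵥ y := by
  obtain ⟨κ, hκ, hf⟩ := exists_inflation_rotation hq hZ hd hpos hinv i hy hy1
  obtain ⟨t, ht, hle⟩ := exists_sin_sq_pos_of_eventually
    ((tendsto_replaceCol_rotation hZ i hy hy1).eventually hmin)
  rw [hf t, le_add_iff_nonneg_right] at hle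
  have := nonneg_of_mul_nonneg_right (nonneg_of_mul_nonneg_right hle ht) hκ
  linarith

/-- The Hessian of the Lagrangian at an invariant stationary frame, in the direction that moves the
`i`-th column towards the orthogonal unit vector `y`, is a positive multiple of `y · M y - dᵢ`. The
diagonal entry of the multiplier is found from the vanishing derivative in the direction that
scales the `i`-th column. -/
theorem exists_hessian_eq (hq : q + 1 ≤ p) (hZ : Z ∈ stiefel n p)
    (hd : Zᵀ * (Aᵀ * A) * Z = diagonal d) (hpos : 0 < inflation A (q + 1) Z)
    (hinv : Aᵀ * A * Z = Z * diagonal d) {Λ : Matrix (Fin p) (Fin p) ℝ}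
    (hΛ : IsMultiplier A (q + 1) Z Λ) (i : Fin p)
    {y : Fin n → ℝ} (hy : Zᵀ *ᵥ y = 0) (hy1 : y ⬝ᵥ y = 1) :
    ∃ κ : ℝ, 0 < κ ∧ hessian A (q + 1) Λ Z (vecMulVec y (Pi.single i 1)) =
      κ * (y ⬝ᵥ (Aᵀ * A) *ᵥ y - d i) := by
  have hM := transpose_eq_of_posSemidef (posSemidef_transpose_mul_self A)
  obtain ⟨g, h, c, e, -, hg, hh, hc, he, hf⟩ := exists_inflation_replaceCol hq hZ hd hpos i hy hy1
  have hcross := cross_eq_zero_of_mul_eq hM hinv hy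
  have hne : c + e ≠ 0 := by positivity
  refine ⟨2 * h / (c + e), by positivity, ?_⟩
  have hL (α β : ℝ) := lagrangian_replaceCol (A := A) (q := q + 1) hZ Λ i hy hy1 α β
  simp only [hf, hg hcross, hcross] at hL
  set ν := y ⬝ᵥ (Aᵀ * A) *ᵥ y
  have h0 := hΛ.2 (vecMulVec (Zᵀ i) (Pi.single i 1))
  simp only [replaceCol_one_add_eq Z i y, hL] at h0
  rw [(hasDerivAt_scaling (g 0) (d i) ν h (Λ i i) hne).deriv] at h0
  have hH : (fun t : ℝ => lagrangian A (q + 1) Λ (Z + t • vecMulVec y (Pi.single i 1))) =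
      fun t => ((g 0 + d i * h) + (ν * h) * t ^ 2) / ((c + e) + e * t ^ 2) + Λ i i * t ^ 2 := by
    ext t
    rw [replaceCol_one_eq, hL]
    congr 1
    · congr 1 <;> ring
    · ring
  rw [hessian, hH, iteratedDeriv_two_quadratic_quotient _ _ _ (by positivity) he.le]
  have hℓ : 2 * Λ i i = - ((2 * (d i * h) * (c + e) - (g 0 + d i * h) * (2 * e)) / (c + e) ^ 2) := by
    linarith
  rw [hℓ]
  field_simp
  ring

theorem vecMulVec_mem_tangentSpace {y : Fin n → ℝ} (hy : Zᵀ *ᵥ y = 0) (u : Fin p → ℝ) :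
    vecMulVec y u ∈ tangentSpace Z := by
  have h1 : Zᵀ * vecMulVec y u = 0 := by rw [mul_vecMulVec, hy, zero_vecMulVec]
  have h2 : (vecMulVec y u)ᵀ * Z = 0 := by
    have := congrArg transpose h1
    rwa [transpose_mul, transpose_transpose, transpose_zero] at this
  rw [tangentSpace, Set.mem_ofPred_eq, h1, h2, add_zero]

end Critical

/-! ### Local and global optimality -/

section Dominant

variable {m n p q : ℕ} {A : Matrix (Fin m) (Fin n) ℝ}

/-- The columns of `Z` are eigenvectors of `M` with eigenvalues `d`, and on the orthogonal complement
of their span the quadratic form of `M` is bounded by every `d i`. -/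
def IsDominantFrame (M : Matrix (Fin n) (Fin n) ℝ) (Z : Matrix (Fin n) (Fin p) ℝ)
    (d : Fin p → ℝ) : Prop :=
  M * Z = Z * diagonal d ∧ ∀ i y, Zᵀ *ᵥ y = 0 → y ⬝ᵥ y = 1 → y ⬝ᵥ M *ᵥ y ≤ d i

theorem isMaxOn_iff_compression (hqp : q ≤ p) {X : Matrix (Fin n) (Fin p) ℝ}
    (hX : X ∈ stiefel n p) : IsMaxOn (inflation A q) (stiefel n p) X ↔ ∀ Y ∈ stiefel n p,
      esymmMatrix q (Yᵀ * (Aᵀ * A) * Y) ≤ esymmMatrix q (Xᵀ * (Aᵀ * A) * X) := by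
  rw [isMaxOn_iff]
  refine forall₂_congr fun Y hY => ?_
  rw [inflation_eq_of_mem A q hX, inflation_eq_of_mem A q hY,
    div_le_div_iff_of_pos_right (esymmMatrix_one_pos hqp)]

theorem isMinOn_iff_compression (hqp : q ≤ p) {X : Matrix (Fin n) (Fin p) ℝ}
    (hX : X ∈ stiefel n p) : IsMinOn (inflation A q) (stiefel n p) X ↔ ∀ Y ∈ stiefel n p,
      esymmMatrix q (Xᵀ * (Aᵀ * A) * X) ≤ esymmMatrix q (Yᵀ * (Aᵀ * A) * Y) := by
  rw [isMinOn_iff]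
  refine forall₂_congr fun Y hY => ?_
  rw [inflation_eq_of_mem A q hX, inflation_eq_of_mem A q hY,
    div_le_div_iff_of_pos_right (esymmMatrix_one_pos hqp)]

theorem compression_eq_of_mul_eq {M : Matrix (Fin n) (Fin n) ℝ} {Z : Matrix (Fin n) (Fin p) ℝ}
    (hZ : Z ∈ stiefel n p) {B : Matrix (Fin p) (Fin p) ℝ} (h : M * Z = Z * B) :
    Zᵀ * M * Z = B := by
  rw [Matrix.mul_assoc, h, ← Matrix.mul_assoc, show Zᵀ * Z = 1 from hZ, Matrix.one_mul]

theorem eigenvalue_nonneg_of_mul_eq {M : Matrix (Fin n) (Fin n) ℝ} (hM : M.PosSemidef)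
    {Z : Matrix (Fin n) (Fin p) ℝ} {d : Fin p → ℝ} (hZ : Z ∈ stiefel n p)
    (h : M * Z = Z * diagonal d) (i : Fin p) : 0 ≤ d i := by
  have := posSemidef_transpose_mul_mul hM Z
  rw [compression_eq_of_mul_eq hZ h] at this
  exact posSemidef_diagonal_iff.1 this i

theorem quadForm_le_of_unit {M : Matrix (Fin n) (Fin n) ℝ} {Z : Matrix (Fin n) (Fin p) ℝ} {μ : ℝ}
    (h : ∀ y, Zᵀ *ᵥ y = 0 → y ⬝ᵥ y = 1 → y ⬝ᵥ M *ᵥ y ≤ μ) (y : Fin n → ℝ) (hy : Zᵀ *ᵥ y = 0) :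
    y ⬝ᵥ M *ᵥ y ≤ μ * (y ⬝ᵥ y) := by
  by_cases hy0 : y = 0
  · simp [hy0]
  obtain ⟨c, hc, hc1⟩ := exists_smul_dotProduct_self_eq_one hy0
  have := h (c • y) (by rw [mulVec_smul, hy, smul_zero]) hc1
  simp only [mulVec_smul, smul_dotProduct, dotProduct_smul, smul_eq_mul] at this hc1
  have hc2 : 0 < c * c := mul_self_pos.2 hc
  refine le_of_mul_le_mul_left ?_ hc2
  calc c * c * (y ⬝ᵥ M *ᵥ y) ≤ μ * (c * (c * (y ⬝ᵥ y))) := by rw [hc1]; linarith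
    _ = c * c * (μ * (y ⬝ᵥ y)) := by ring

theorem smul_one_eq_diagonal_const (μ : ℝ) : (μ • 1 : Matrix (Fin p) (Fin p) ℝ) =
    diagonal fun _ => μ := smul_one_eq_diagonal μ

theorem IsDominantFrame.isMaxOn {Z : Matrix (Fin n) (Fin p) ℝ} {d : Fin p → ℝ}
    (h : IsDominantFrame (Aᵀ * A) Z d) (hZ : Z ∈ stiefel n p) (hp : 0 < p) (hqp : q ≤ p) :
    IsMaxOn (inflation A q) (stiefel n p) Z := by
  have hM := posSemidef_transpose_mul_self A
  have : Nonempty (Fin p) := ⟨⟨0, hp⟩⟩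
  obtain ⟨i, hi⟩ := Finite.exists_min d
  rw [isMaxOn_iff_compression hqp hZ, compression_eq_of_mul_eq hZ h.1]
  intro Y hY
  refine esymmMatrix_compression_le (μ := d i) q hM hZ hY h.1 (eigenvalue_nonneg_of_mul_eq hM hZ h.1 i)
    ?_ (quadForm_le_of_unit (h.2 i))
  rw [smul_one_eq_diagonal_const, diagonal_sub]
  exact PosSemidef.diagonal fun k => sub_nonneg.2 (hi k)

theorem isMinOn_of_le_quadForm {Z : Matrix (Fin n) (Fin p) ℝ} {d : Fin p → ℝ}
    (hZ : Z ∈ stiefel n p) (hinv : Aᵀ * A * Z = Z * diagonal d)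
    (h : ∀ i y, Zᵀ *ᵥ y = 0 → y ⬝ᵥ y = 1 → d i ≤ y ⬝ᵥ (Aᵀ * A) *ᵥ y) (hp : 0 < p) (hqp : q ≤ p) :
    IsMinOn (inflation A q) (stiefel n p) Z := by
  have hM := posSemidef_transpose_mul_self A
  have : Nonempty (Fin p) := ⟨⟨0, hp⟩⟩
  obtain ⟨i, hi⟩ := Finite.exists_max d
  have hd0 := eigenvalue_nonneg_of_mul_eq hM hZ hinv
  rw [isMinOn_iff_compression hqp hZ, compression_eq_of_mul_eq hZ hinv]
  intro Y hY
  refine le_esymmMatrix_compression (μ := d i) q hM hZ hY hinv (hd0 i) (PosSemidef.diagonal hd0)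
    ?_ fun y hy => ?_
  · rw [smul_one_eq_diagonal_const, diagonal_sub]
    exact PosSemidef.diagonal fun k => sub_nonneg.2 (hi k)
  · have := quadForm_le_of_unit (M := -(Aᵀ * A)) (Z := Z) (μ := -d i) (fun y hy hy1 => by
      simpa [neg_mulVec] using h i y hy hy1) y hy
    simpa [neg_mulVec] using this

theorem isMaxOn_of_mul_orthogonal {Q : Matrix (Fin p) (Fin p) ℝ} (hQ : Qᵀ * Q = 1)
    {X : Matrix (Fin n) (Fin p) ℝ} (h : IsMaxOn (inflation A q) (stiefel n p) (X * Q)) :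
    IsMaxOn (inflation A q) (stiefel n p) X := by
  rw [isMaxOn_iff] at *
  rwa [inflation_mul_orthogonal A q hQ] at h

theorem isMinOn_of_mul_orthogonal {Q : Matrix (Fin p) (Fin p) ℝ} (hQ : Qᵀ * Q = 1)
    {X : Matrix (Fin n) (Fin p) ℝ} (h : IsMinOn (inflation A q) (stiefel n p) (X * Q)) :
    IsMinOn (inflation A q) (stiefel n p) X := by
  rw [isMinOn_iff] at *
  rwa [inflation_mul_orthogonal A q hQ] at h

/-- Every frame can be rotated within its range so that it diagonalises `Aᵀ A`, with nonincreasing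
diagonal. -/
theorem exists_diagonalizing_rotation (A : Matrix (Fin m) (Fin n) ℝ)
    (X : Matrix (Fin n) (Fin p) ℝ) :
    ∃ (Q : Matrix (Fin p) (Fin p) ℝ) (d : Fin p → ℝ), Qᵀ * Q = 1 ∧ Antitone d ∧
      (X * Q)ᵀ * (Aᵀ * A) * (X * Q) = diagonal d := by
  obtain ⟨Q, d, hQ, hdm, hd⟩ :=
    exists_sorted_orthogonal_diagonalization (posSemidef_compression A X).1
  exact ⟨Q, d, hQ, hdm, by rw [compression_mul, hd]⟩

theorem isDominantFrame_of_isLocalMaxOn (hq : q + 1 ≤ p) {Z : Matrix (Fin n) (Fin p) ℝ}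
    {d : Fin p → ℝ} (hZ : Z ∈ stiefel n p) (hd : Zᵀ * (Aᵀ * A) * Z = diagonal d)
    (hpos : 0 < inflation A (q + 1) Z)
    (h : IsLocalMaxOn (inflation A (q + 1)) (stiefel n p) Z) : IsDominantFrame (Aᵀ * A) Z d := by
  have hM := transpose_eq_of_posSemidef (posSemidef_transpose_mul_self A)
  have hinv := mul_eq_of_cross_eq_zero hM hZ hd fun i y hy hy1 =>
    cross_eq_zero_of_isLocalExtrOn hq hZ hd hpos h.isExtr i hy hy1
  exact ⟨hinv, fun i y hy hy1 => quadForm_le_of_isLocalMaxOn hq hZ hd hpos hinv h i hy hy1⟩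

theorem inflation_eq_zero_of_rank_lt (hqp : q ≤ p) (hr : A.rank < q) {X : Matrix (Fin n) (Fin p) ℝ}
    (hX : X ∈ stiefel n p) : inflation A q X = 0 := by
  by_contra h
  have h1 := (inflation_pos_iff A hqp hX).1 ((inflation_nonneg A q X).lt_of_ne' h)
  exact (h1.trans (rank_mul_le_left A X)).not_gt hr

/-- A local maximiser is global: if `A` has rank below `q` the objective vanishes identically, and
otherwise it is positive at the local maximiser, which is then a dominant frame. -/
theorem isMaxOn_of_isLocalMaxOn (hq : q + 1 ≤ p) {X : Matrix (Fin n) (Fin p) ℝ}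
    (hX : X ∈ stiefel n p) (h : IsLocalMaxOn (inflation A (q + 1)) (stiefel n p) X) :
    IsMaxOn (inflation A (q + 1)) (stiefel n p) X := by
  rcases lt_or_ge A.rank (q + 1) with hr | hr
  · rw [isMaxOn_iff]
    intro Y hY
    rw [inflation_eq_zero_of_rank_lt hq hr hY, inflation_eq_zero_of_rank_lt hq hr hX]
  · obtain ⟨Q, d, hQ, -, hd⟩ := exists_diagonalizing_rotation A X
    have hZ := mul_orthogonal_mem_stiefel hX hQ
    have hpos := inflation_pos_of_isLocalMaxOn hq hr hX h
    rw [← inflation_mul_orthogonal A _ hQ] at hpos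
    exact isMaxOn_of_mul_orthogonal hQ ((isDominantFrame_of_isLocalMaxOn hq hZ hd hpos
      (isLocalMaxOn_mul_orthogonal hQ h)).isMaxOn hZ (by omega) hq)

theorem isMinOn_of_not_inflation_pos {X : Matrix (Fin n) (Fin p) ℝ}
    (h : ¬ 0 < inflation A q X) : IsMinOn (inflation A q) (stiefel n p) X := by
  rw [isMinOn_iff]
  exact fun Y _ => (not_lt.1 h).trans (inflation_nonneg A q Y)

theorem isMinOn_of_isLocalMinOn (hq : q + 1 ≤ p) {X : Matrix (Fin n) (Fin p) ℝ}
    (hX : X ∈ stiefel n p) (h : IsLocalMinOn (inflation A (q + 1)) (stiefel n p) X) :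
    IsMinOn (inflation A (q + 1)) (stiefel n p) X := by
  by_cases hpos : 0 < inflation A (q + 1) X
  swap
  · exact isMinOn_of_not_inflation_pos hpos
  have hM := transpose_eq_of_posSemidef (posSemidef_transpose_mul_self A)
  obtain ⟨Q, d, hQ, -, hd⟩ := exists_diagonalizing_rotation A X
  have hZ := mul_orthogonal_mem_stiefel hX hQ
  rw [← inflation_mul_orthogonal A _ hQ] at hpos
  have hZmin := isLocalMinOn_mul_orthogonal hQ h
  have hinv := mul_eq_of_cross_eq_zero hM hZ hd fun i y hy hy1 =>
    cross_eq_zero_of_isLocalExtrOn hq hZ hd hpos hZmin.isExtr i hy hy1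
  exact isMinOn_of_mul_orthogonal hQ (isMinOn_of_le_quadForm hZ hinv (fun i y hy hy1 =>
    le_quadForm_of_isLocalMinOn hq hZ hd hpos hinv hZmin i hy hy1) (by omega) hq)

theorem isStrictSaddle_of_isStationaryPoint (hq : q + 1 ≤ p) {X : Matrix (Fin n) (Fin p) ℝ}
    (h : IsStationaryPoint A (q + 1) X)
    (hmax : ¬ IsLocalMaxOn (inflation A (q + 1)) (stiefel n p) X)
    (hmin : ¬ IsLocalMinOn (inflation A (q + 1)) (stiefel n p) X) :
    IsStrictSaddle A (q + 1) X := by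
  obtain ⟨hX, Λ, hΛ⟩ := h
  have hM := transpose_eq_of_posSemidef (posSemidef_transpose_mul_self A)
  have hpos : 0 < inflation A (q + 1) X := by
    by_contra hpos
    exact hmin (isMinOn_of_not_inflation_pos hpos).localize
  obtain ⟨Q, d, hQ, -, hd⟩ := exists_diagonalizing_rotation A X
  have hZ := mul_orthogonal_mem_stiefel hX hQ
  rw [← inflation_mul_orthogonal A _ hQ] at hpos
  replace hΛ := hΛ.mul_orthogonal hQ
  have hinv := mul_eq_of_cross_eq_zero hM hZ hd fun i y hy hy1 =>
    cross_eq_zero_of_isMultiplier hq hZ hd hpos hΛ i hy hy1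
  have hsaddle : IsStrictSaddle A (q + 1) (X * Q) := by
    refine ⟨hZ, _, hΛ, ?_, ?_⟩
    · by_contra! hcon
      refine hmax (isMaxOn_of_mul_orthogonal hQ (IsDominantFrame.isMaxOn (d := d)
        ⟨hinv, fun i y hy hy1 => ?_⟩ hZ (by omega) hq)).localize
      obtain ⟨κ, hκ, hH⟩ := exists_hessian_eq hq hZ hd hpos hinv hΛ i hy hy1
      have := hcon _ (vecMulVec_mem_tangentSpace hy (Pi.single i 1))
      rw [hH] at this
      linarith [nonpos_of_mul_nonpos_right this hκ]
    · by_contra! hcon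
      refine hmin (isMinOn_of_mul_orthogonal hQ (isMinOn_of_le_quadForm hZ hinv
        (fun i y hy hy1 => ?_) (by omega) hq)).localize
      obtain ⟨κ, hκ, hH⟩ := exists_hessian_eq hq hZ hd hpos hinv hΛ i hy hy1
      have := hcon _ (vecMulVec_mem_tangentSpace hy (Pi.single i 1))
      rw [hH] at this
      linarith [nonneg_of_mul_nonneg_right this hκ]
  have hQt : Qᵀᵀ * Qᵀ = 1 := by rw [transpose_transpose]; exact mul_transpose_eq_one hQ
  have := hsaddle.mul_orthogonal hQt
  rwa [mul_mul_transpose_cancel hQ] at this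

end Dominant

/-! ### Singular value decompositions -/

section SingularValueDecomposition

variable {m n p q : ℕ} {A : Matrix (Fin m) (Fin n) ℝ}

theorem transpose_mul_apply_eq_dotProduct {k l : ℕ} (X : Matrix (Fin n) (Fin k) ℝ)
    (Y : Matrix (Fin n) (Fin l) ℝ) (i : Fin k) (j : Fin l) : (Xᵀ * Y) i j = Xᵀ i ⬝ᵥ Yᵀ j :=
  rfl

/-- Vectors that are orthonormal on the index set `s` are the corresponding columns of an orthogonal
matrix. -/
theorem exists_orthogonal_extension {N : ℕ} (v : Fin N → Fin N → ℝ) (s : Set (Fin N))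
    (hv : ∀ i ∈ s, ∀ j ∈ s, v i ⬝ᵥ v j = if i = j then 1 else 0) :
    ∃ U : Matrix (Fin N) (Fin N) ℝ, Uᵀ * U = 1 ∧ ∀ i ∈ s, Uᵀ i = v i := by
  let w : Fin N → EuclideanSpace ℝ (Fin N) := fun i => WithLp.toLp 2 (v i)
  have hw : Orthonormal ℝ (s.domRestrict w) := by
    rw [orthonormal_iff_ite]
    rintro ⟨i, hi⟩ ⟨j, hj⟩
    rw [Set.domRestrict_apply, Set.domRestrict_apply, EuclideanSpace.inner_toLp_toLp, star_trivial,
      dotProduct_comm, hv i hi j hj]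
    simp only [Subtype.mk.injEq]
  obtain ⟨b, hb⟩ := hw.exists_orthonormalBasis_extension_of_card_eq (by simp)
  refine ⟨Matrix.of fun k i => b i k, ?_, fun i hi => ?_⟩
  · ext i j
    have h := orthonormal_iff_ite.1 b.orthonormal i j
    rw [EuclideanSpace.inner_eq_star_dotProduct, star_trivial, dotProduct_comm] at h
    rw [Matrix.mul_apply', one_apply]
    exact h
  · ext k
    change b i k = v i k
    rw [hb i hi]

theorem exists_orthogonal_complement {k : ℕ} {Z : Matrix (Fin (p + k)) (Fin p) ℝ}
    (hZ : Z ∈ stiefel (p + k) p) :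
    ∃ Y : Matrix (Fin (p + k)) (Fin k) ℝ, Yᵀ * Y = 1 ∧ Zᵀ * Y = 0 := by
  have hZ' : Zᵀ * Z = 1 := hZ
  obtain ⟨U, hU, hUZ⟩ := exists_orthogonal_extension
    (Fin.append (fun i => Zᵀ i) (fun _ : Fin k => 0)) (Set.range (Fin.castAdd k)) (by
      rintro _ ⟨i, rfl⟩ _ ⟨j, rfl⟩
      have := congrFun (congrFun hZ' i) j
      rw [transpose_mul_apply_eq_dotProduct, one_apply] at this
      simpa using this)
  have hcol (i : Fin p) : Uᵀ (Fin.castAdd k i) = Zᵀ i := by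
    rw [hUZ _ ⟨i, rfl⟩, Fin.append_left]
  have hUe (i j : Fin (p + k)) : Uᵀ i ⬝ᵥ Uᵀ j = if i = j then 1 else 0 := by
    have := congrFun (congrFun hU i) j
    rwa [Matrix.mul_apply', one_apply] at this
  refine ⟨U.submatrix id (Fin.natAdd p), ?_, ?_⟩
  · ext i j
    have := hUe (Fin.natAdd p i) (Fin.natAdd p j)
    rw [transpose_mul_apply_eq_dotProduct, one_apply]
    simp only [(Fin.natAdd_injective k p).eq_iff] at this
    exact this
  · ext i j
    have := hUe (Fin.castAdd k i) (Fin.natAdd p j)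
    rw [hcol, if_neg (by simp [Fin.ext_iff]; omega)] at this
    rw [Matrix.mul_apply']
    exact this

/-- An orthogonal matrix diagonalising `Aᵀ A` with nonincreasing diagonal is the right factor of a
singular value decomposition of `A`. -/
theorem exists_svd_of_gram_diagonal {V : Matrix (Fin n) (Fin n) ℝ} (hV : Vᵀ * V = 1)
    {D : Fin n → ℝ} (hD : Antitone D) (hVD : Vᵀ * (Aᵀ * A) * V = diagonal D) :
    ∃ U ∈ orthogonalGroup (Fin m) ℝ, ∃ σ : ℕ → ℝ, Antitone σ ∧ (∀ i, 0 ≤ σ i) ∧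
      A = U * (Matrix.of fun (i : Fin m) (j : Fin n) =>
        if (i : ℕ) = (j : ℕ) then σ i else 0) * Vᵀ := by
  have hAV (i j : Fin n) : (A *ᵥ Vᵀ i) ⬝ᵥ (A *ᵥ Vᵀ j) = diagonal D i j := by
    rw [← hVD, transpose_mul_mul_apply, mulVec_dotProduct_eq, mulVec_mulVec]
  have hD0 (i : Fin n) : 0 ≤ D i := by
    have := hAV i i
    rw [diagonal_apply_eq] at this
    rw [← this]
    exact dotProduct_self_star_nonneg (A *ᵥ Vᵀ i)
  -- a positive diagonal entry has index below the rank of `A`, hence below `m`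
  have hlt (j : Fin n) (hj : 0 < D j) : (j : ℕ) < m := by
    have hVu : IsUnit V.det :=
      (isUnit_iff_isUnit_det V).1 (IsUnit.of_mul_eq_one _ (mul_transpose_eq_one hV))
    have h1 : A.rank = Fintype.card {i // D i ≠ 0} := by
      rw [← rank_diagonal, ← hVD, ← rank_mul_eq_left_of_isUnit_det V A hVu,
        ← rank_transpose_mul_self (A * V)]
      simp only [transpose_mul, Matrix.mul_assoc]
    have h2 : (j : ℕ) + 1 ≤ Fintype.card {i // D i ≠ 0} := by
      rw [Fintype.card_subtype, ← Fin.card_Iic j]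
      refine Finset.card_le_card fun i hi => Finset.mem_filter.2 ⟨Finset.mem_univ _, ?_⟩
      exact (hj.trans_le (hD (Finset.mem_Iic.1 hi))).ne'
    have h3 := A.rank_le_height
    omega
  let σ : ℕ → ℝ := fun i => if h : i < n then √(D ⟨i, h⟩) else 0
  have hσ (j : Fin n) : σ j = √(D j) := dif_pos j.2
  let v : Fin m → Fin m → ℝ := fun i =>
    if h : (i : ℕ) < n then (σ i)⁻¹ • (A *ᵥ Vᵀ ⟨i, h⟩) else 0
  obtain ⟨U, hU, hUv⟩ := exists_orthogonal_extension v
    {i | ∃ h : (i : ℕ) < n, 0 < D ⟨i, h⟩} (by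
      rintro i ⟨hi, hDi⟩ j ⟨hj, hDj⟩
      simp only [v, σ, dif_pos hi, dif_pos hj, smul_dotProduct, dotProduct_smul, hAV, smul_eq_mul]
      by_cases hij : i = j
      · subst hij
        have hs := Real.sqrt_pos.2 hDi
        rw [diagonal_apply_eq, if_pos rfl]
        field_simp
        rw [Real.sq_sqrt hDi.le]
      · rw [diagonal_apply_ne _ (by simpa [Fin.ext_iff] using hij), if_neg hij]
        simp)
  refine ⟨U, (mem_orthogonalGroup_iff' _ _).2 hU, σ, ?_, ?_, ?_⟩
  · intro i j hij
    by_cases hj : j < n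
    · have hi := hij.trans_lt hj
      simp only [σ, dif_pos hi, dif_pos hj]
      exact Real.sqrt_le_sqrt (hD (Fin.mk_le_mk.2 hij))
    · simp only [σ, dif_neg hj]
      split_ifs
      exacts [Real.sqrt_nonneg _, le_rfl]
  · intro i
    simp only [σ]
    split_ifs
    exacts [Real.sqrt_nonneg _, le_rfl]
  · have hmain : A * V = U * (Matrix.of fun (i : Fin m) (j : Fin n) =>
        if (i : ℕ) = (j : ℕ) then σ i else 0) := by
      ext l j
      change (A *ᵥ Vᵀ j) l = _
      rw [Matrix.mul_apply]
      rcases (hD0 j).eq_or_lt with h0 | h0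
      · have hz : A *ᵥ Vᵀ j = 0 := by
          have := hAV j j
          rw [diagonal_apply_eq, ← h0] at this
          exact dotProduct_self_eq_zero.1 this
        rw [hz, Pi.zero_apply, Finset.sum_eq_zero]
        intro i _
        rw [of_apply]
        split_ifs with hij
        · rw [hij, hσ, ← h0, Real.sqrt_zero, mul_zero]
        · rw [mul_zero]
      · have hjm := hlt j h0
        rw [Finset.sum_eq_single (⟨j, hjm⟩ : Fin m)]
        · have hcol := congrFun (hUv ⟨j, hjm⟩ ⟨j.2, h0⟩) l
          simp only [v, dif_pos j.2, hσ, Pi.smul_apply, smul_eq_mul] at hcol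
          rw [transpose_apply] at hcol
          rw [of_apply, if_pos rfl, hcol, hσ]
          have := (Real.sqrt_pos.2 h0).ne'
          field_simp
        · intro i _ hij
          rw [of_apply, if_neg (fun h => hij (Fin.ext h)), mul_zero]
        · simp
    rw [← hmain, mul_mul_transpose_cancel hV]

/-- A dominant frame with nonincreasing eigenvalues is completed to an orthogonal diagonalisation of
`Aᵀ A` by eigenvectors on the orthogonal complement, so it is a leading right singular factor. -/
theorem IsDominantFrame.isLeadingRightSingularFactor (hpn : p ≤ n) {Z : Matrix (Fin n) (Fin p) ℝ}
    {d : Fin p → ℝ} (h : IsDominantFrame (Aᵀ * A) Z d) (hZ : Z ∈ stiefel n p) (hd : Antitone d) :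
    IsLeadingRightSingularFactor hpn A Z := by
  obtain ⟨k, rfl⟩ := Nat.exists_eq_add_of_le hpn
  have hM := transpose_eq_of_posSemidef (posSemidef_transpose_mul_self A)
  obtain ⟨Y, hY, hZY⟩ := exists_orthogonal_complement hZ
  obtain ⟨Q, e, hQ, he, hYe⟩ := exists_diagonalizing_rotation A Y
  set W := Y * Q with hW
  have hW1 : Wᵀ * W = 1 := mul_orthogonal_mem_stiefel hY hQ
  have hZW : Zᵀ * W = 0 := by rw [hW, ← Matrix.mul_assoc, hZY, Matrix.zero_mul]
  have hZ' : Zᵀ * Z = 1 := hZ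
  have hcol (j : Fin k) : Zᵀ *ᵥ Wᵀ j = 0 := by
    ext i
    exact congrFun (congrFun hZW i) j
  have e₁ (i j : Fin p) : Zᵀ i ⬝ᵥ Zᵀ j = (1 : Matrix _ _ ℝ) i j := congrFun (congrFun hZ' i) j
  have e₂ (i : Fin p) (j : Fin k) : Zᵀ i ⬝ᵥ Wᵀ j = 0 := congrFun (congrFun hZW i) j
  have e₃ (i j : Fin k) : Wᵀ i ⬝ᵥ Wᵀ j = (1 : Matrix _ _ ℝ) i j := congrFun (congrFun hW1 i) j
  have f₁ (i j : Fin p) : Zᵀ i ⬝ᵥ (Aᵀ * A) *ᵥ Zᵀ j = diagonal d i j := by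
    rw [← transpose_mul_mul_apply, compression_eq_of_mul_eq hZ h.1]
  have f₂ (i : Fin p) (j : Fin k) : Zᵀ i ⬝ᵥ (Aᵀ * A) *ᵥ Wᵀ j = 0 :=
    cross_eq_zero_of_mul_eq hM h.1 (hcol j) i
  have f₃ (i j : Fin k) : Wᵀ i ⬝ᵥ (Aᵀ * A) *ᵥ Wᵀ j = diagonal e i j := by
    rw [← transpose_mul_mul_apply, hYe]
  have hed (i : Fin p) (j : Fin k) : e j ≤ d i := by
    have := h.2 i (Wᵀ j) (hcol j) (by rw [e₃, one_apply_eq])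
    rwa [f₃, diagonal_apply_eq] at this
  let V : Matrix (Fin (p + k)) (Fin (p + k)) ℝ :=
    (Matrix.of (Fin.append (fun i => Zᵀ i) (fun j => Wᵀ j)))ᵀ
  have hVl (i : Fin p) : Vᵀ (Fin.castAdd k i) = Zᵀ i := Fin.append_left _ _ i
  have hVr (j : Fin k) : Vᵀ (Fin.natAdd p j) = Wᵀ j := Fin.append_right _ _ j
  have hne (i : Fin p) (j : Fin k) : Fin.castAdd k i ≠ Fin.natAdd p j := by
    simp [Fin.ext_iff]
    omega
  have hV : Vᵀ * V = 1 := by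
    ext i j
    rw [Matrix.mul_apply']
    change Vᵀ i ⬝ᵥ Vᵀ j = _
    refine Fin.addCases (fun i => ?_) (fun i => ?_) i <;>
      refine Fin.addCases (fun j => ?_) (fun j => ?_) j
    · rw [hVl, hVl, e₁]; simp [one_apply]
    · rw [hVl, hVr, e₂, one_apply_ne (hne i j)]
    · rw [hVl, hVr, dotProduct_comm, e₂, one_apply_ne (hne j i).symm]
    · rw [hVr, hVr, e₃]; simp [one_apply]
  have hVD : Vᵀ * (Aᵀ * A) * V = diagonal (Fin.append d e) := by
    ext i j
    rw [transpose_mul_mul_apply]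
    refine Fin.addCases (fun i => ?_) (fun i => ?_) i <;>
      refine Fin.addCases (fun j => ?_) (fun j => ?_) j
    · rw [hVl, hVl, f₁]; simp [diagonal_apply]
    · rw [hVl, hVr, f₂, diagonal_apply_ne _ (hne i j)]
    · rw [hVl, hVr, dotProduct_mulVec_comm hM, f₂, diagonal_apply_ne _ (hne j i).symm]
    · rw [hVr, hVr, f₃]; simp [diagonal_apply]
  have hanti : Antitone (Fin.append d e) := by
    intro i j
    refine Fin.addCases (fun i => ?_) (fun i => ?_) i <;>
      refine Fin.addCases (fun j => ?_) (fun j => ?_) j <;> intro hij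
    · simpa using hd (a := i) (b := j) hij
    · simpa using hed i j
    · simp [Fin.le_def] at hij
      omega
    · simpa using he ((Fin.natAdd_le_natAdd_iff p).1 hij)
  obtain ⟨U, hU, σ, hσ, hσ0, hA⟩ := exists_svd_of_gram_diagonal hV hanti hVD
  refine ⟨U, hU, V, (mem_orthogonalGroup_iff' _ _).2 hV, σ, hσ, hσ0, hA, ?_⟩
  ext l i
  exact (congrFun (hVl i) l).symm

/-- A leading right singular factor is a dominant frame. -/
theorem IsLeadingRightSingularFactor.exists_isDominantFrame {hpn : p ≤ n}
    {Vp : Matrix (Fin n) (Fin p) ℝ} (h : IsLeadingRightSingularFactor hpn A Vp) :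
    Vp ∈ stiefel n p ∧ ∃ d, IsDominantFrame (Aᵀ * A) Vp d := by
  obtain ⟨U, hU, V, hV, σ, hσ, hσ0, hA, rfl⟩ := h
  have hU' : Uᵀ * U = 1 := (mem_orthogonalGroup_iff' _ _).1 hU
  have hV' : Vᵀ * V = 1 := (mem_orthogonalGroup_iff' _ _).1 hV
  let D : Fin n → ℝ := fun j => if (j : ℕ) < m then σ j ^ 2 else 0
  have hD : Antitone D := by
    intro i j hij
    have hij' : (i : ℕ) ≤ j := hij
    simp only [D]
    split_ifs
    · exact pow_le_pow_left₀ (hσ0 _) (hσ hij') 2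
    · omega
    · positivity
    · exact le_rfl
  have hS : (Matrix.of fun (i : Fin m) (j : Fin n) => if (i : ℕ) = (j : ℕ) then σ i else 0)ᵀ *
      (Matrix.of fun (i : Fin m) (j : Fin n) => if (i : ℕ) = (j : ℕ) then σ i else 0) =
      diagonal D := by
    ext i j
    rw [Matrix.mul_apply]
    simp only [transpose_apply, of_apply]
    by_cases hi : (i : ℕ) < m
    · rw [Finset.sum_eq_single (⟨i, hi⟩ : Fin m)]
      · by_cases hij : i = j
        · subst hij
          simp [D, hi, sq]
        · simp [hij, Fin.ext_iff.not.1 hij]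
      · intro l _ hl
        rw [if_neg (fun h => hl (Fin.ext h)), zero_mul]
      · simp
    · rw [Finset.sum_eq_zero]
      · by_cases hij : i = j
        · subst hij
          simp [D, hi]
        · simp [hij]
      · intro l _
        rw [if_neg (by omega), zero_mul]
  have hM : Aᵀ * A = V * diagonal D * Vᵀ := by
    rw [← hS]
    generalize (Matrix.of fun (i : Fin m) (j : Fin n) =>
      if (i : ℕ) = (j : ℕ) then σ i else 0) = S at hA
    rw [hA]
    simp only [transpose_mul, transpose_transpose, Matrix.mul_assoc]
    rw [← Matrix.mul_assoc Uᵀ, hU', Matrix.one_mul]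
  have hMV : Aᵀ * A * V = V * diagonal D := by rw [hM, mul_transpose_mul_cancel hV']
  refine ⟨?_, D ∘ Fin.castLE hpn, ?_, fun i y hy hy1 => ?_⟩
  · change (V.submatrix id (Fin.castLE hpn))ᵀ * V.submatrix id (Fin.castLE hpn) = 1
    rw [transpose_submatrix, ← submatrix_mul _ _ _ _ _ Function.bijective_id, hV',
      submatrix_one _ (Fin.castLE_injective hpn)]
  · ext l i
    have := congrFun (congrFun hMV l) (Fin.castLE hpn i)
    rw [mul_diagonal] at this ⊢
    exact this
  · set u := Vᵀ *ᵥ y with hu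
    have hu0 (j : Fin n) (hj : (j : ℕ) < p) : u j = 0 := congrFun hy ⟨j, hj⟩
    have huu : u ⬝ᵥ u = 1 := by
      rw [hu, mulVec_dotProduct_eq, mulVec_mulVec, transpose_transpose, mul_transpose_eq_one hV',
        one_mulVec, hy1]
    have hq : y ⬝ᵥ (Aᵀ * A) *ᵥ y = ∑ j, D j * (u j * u j) := by
      rw [hM, ← mulVec_mulVec, ← mulVec_mulVec, dotProduct_comm, mulVec_dotProduct_eq, ← hu]
      simp [dotProduct, mulVec_diagonal, mul_assoc]
    calc y ⬝ᵥ (Aᵀ * A) *ᵥ y = ∑ j, D j * (u j * u j) := hq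
      _ ≤ ∑ j, D (Fin.castLE hpn i) * (u j * u j) := by
        refine Finset.sum_le_sum fun j _ => ?_
        by_cases hj : (j : ℕ) < p
        · simp [hu0 j hj]
        · refine mul_le_mul_of_nonneg_right (hD ?_) (mul_self_nonneg _)
          rw [Fin.le_def, Fin.val_castLE]
          omega
      _ = D (Fin.castLE hpn i) := by
        rw [← Finset.mul_sum, show ∑ j, u j * u j = 1 from huu, mul_one]

theorem range_mul_orthogonal {Q : Matrix (Fin p) (Fin p) ℝ} (hQ : Qᵀ * Q = 1)
    (X : Matrix (Fin n) (Fin p) ℝ) :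
    LinearMap.range X.mulVecLin = LinearMap.range (X * Q).mulVecLin := by
  refine le_antisymm ?_ ?_
  · rintro _ ⟨v, rfl⟩
    refine ⟨Qᵀ *ᵥ v, ?_⟩
    rw [mulVecLin_apply, mulVecLin_apply, mulVec_mulVec, mul_mul_transpose_cancel hQ]
  · rintro _ ⟨v, rfl⟩
    refine ⟨Q *ᵥ v, ?_⟩
    rw [mulVecLin_apply, mulVecLin_apply, mulVec_mulVec]

theorem exists_orthogonal_of_range_eq {X Y : Matrix (Fin n) (Fin p) ℝ} (hX : X ∈ stiefel n p)
    (hY : Y ∈ stiefel n p) (h : LinearMap.range X.mulVecLin = LinearMap.range Y.mulVecLin) :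
    ∃ Q : Matrix (Fin p) (Fin p) ℝ, Qᵀ * Q = 1 ∧ X * Q = Y := by
  have hX' : Xᵀ * X = 1 := hX
  have hY' : Yᵀ * Y = 1 := hY
  have hcol (i : Fin p) : ∃ c : Fin p → ℝ, X *ᵥ c = Yᵀ i := by
    have : Yᵀ i ∈ LinearMap.range X.mulVecLin := by
      rw [h, range_mulVecLin]
      exact Submodule.subset_span ⟨i, rfl⟩
    exact this
  choose c hc using hcol
  have hXQ : X * (Matrix.of c)ᵀ = Y := by
    ext l i
    exact congrFun (hc i) l
  refine ⟨(Matrix.of c)ᵀ, ?_, hXQ⟩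
  generalize (Matrix.of c)ᵀ = Q at hXQ
  rw [← hXQ, transpose_mul, Matrix.mul_assoc, ← Matrix.mul_assoc Xᵀ, hX', Matrix.one_mul] at hY'
  exact hY'

theorem isDominantFrame_of_square {Z : Matrix (Fin p) (Fin p) ℝ} {M : Matrix (Fin p) (Fin p) ℝ}
    {d : Fin p → ℝ} (hZ : Zᵀ * Z = 1) (hd : Zᵀ * M * Z = diagonal d) : IsDominantFrame M Z d := by
  refine ⟨?_, fun i y hy hy1 => ?_⟩
  · rw [← hd, ← Matrix.mul_assoc, ← Matrix.mul_assoc, mul_transpose_eq_one hZ, Matrix.one_mul]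
  · have : y = 0 := by
      rw [← one_mulVec y, ← mul_transpose_eq_one hZ, ← mulVec_mulVec, hy, mulVec_zero]
    simp [this] at hy1

theorem isDominantFrame_zero {Z : Matrix (Fin n) (Fin p) ℝ} {d : Fin p → ℝ}
    (hd : Zᵀ * (0 : Matrix (Fin n) (Fin n) ℝ) * Z = diagonal d) :
    IsDominantFrame (0 : Matrix (Fin n) (Fin n) ℝ) Z d := by
  rw [Matrix.mul_zero, Matrix.zero_mul] at hd
  refine ⟨by rw [← hd, Matrix.zero_mul, Matrix.mul_zero], fun i y _ _ => ?_⟩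
  have := congrFun (congrFun hd i) i
  rw [diagonal_apply_eq, Matrix.zero_apply] at this
  simp [← this]

end SingularValueDecomposition

end ElemSymPCA

open ElemSymPCA

theorem theorem4p1 (m n p q : ℕ) (hpn : p ≤ n) (hq : 1 ≤ q) (hqp : q ≤ p)
    (A : Matrix (Fin m) (Fin n) ℝ) :
    -- characterisation of the global maximisers
    ((∀ X ∈ ElemSymPCA.stiefel n p,
        (∃ Vp : Matrix (Fin n) (Fin p) ℝ, ElemSymPCA.IsLeadingRightSingularFactor hpn A Vp ∧
          LinearMap.range X.mulVecLin = LinearMap.range Vp.mulVecLin) →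
        IsMaxOn (ElemSymPCA.inflation A q) (ElemSymPCA.stiefel n p) X) ∧
      ((q ≤ A.rank ∨ A = 0 ∨ p = n) → ∀ X ∈ ElemSymPCA.stiefel n p,
        IsMaxOn (ElemSymPCA.inflation A q) (ElemSymPCA.stiefel n p) X →
        ∃ Vp : Matrix (Fin n) (Fin p) ℝ, ElemSymPCA.IsLeadingRightSingularFactor hpn A Vp ∧
          LinearMap.range X.mulVecLin = LinearMap.range Vp.mulVecLin)) ∧
    -- no spurious local optima, and the other stationary points are strict saddles
    ((∀ X ∈ ElemSymPCA.stiefel n p,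
        IsLocalMaxOn (ElemSymPCA.inflation A q) (ElemSymPCA.stiefel n p) X →
        IsMaxOn (ElemSymPCA.inflation A q) (ElemSymPCA.stiefel n p) X) ∧
      (∀ X ∈ ElemSymPCA.stiefel n p,
        IsLocalMinOn (ElemSymPCA.inflation A q) (ElemSymPCA.stiefel n p) X →
        IsMinOn (ElemSymPCA.inflation A q) (ElemSymPCA.stiefel n p) X) ∧
      (∀ X : Matrix (Fin n) (Fin p) ℝ, ElemSymPCA.IsStationaryPoint A q X →
        ¬ IsLocalMaxOn (ElemSymPCA.inflation A q) (ElemSymPCA.stiefel n p) X →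
        ¬ IsLocalMinOn (ElemSymPCA.inflation A q) (ElemSymPCA.stiefel n p) X →
        ElemSymPCA.IsStrictSaddle A q X)) := by
  obtain ⟨q, rfl⟩ := Nat.exists_eq_add_of_le' hq
  refine ⟨⟨?_, ?_⟩, fun X hX => isMaxOn_of_isLocalMaxOn hqp hX,
    fun X hX => isMinOn_of_isLocalMinOn hqp hX, fun X => isStrictSaddle_of_isStationaryPoint hqp⟩
  · rintro X hX ⟨Vp, hVp, hrange⟩
    obtain ⟨hVpS, d, hd⟩ := hVp.exists_isDominantFrame
    obtain ⟨Q, hQ, hXQ⟩ := exists_orthogonal_of_range_eq hX hVpS hrange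
    refine isMaxOn_of_mul_orthogonal hQ ?_
    rw [hXQ]
    exact hd.isMaxOn hVpS (by omega) hqp
  · intro hcase X hX hmax
    obtain ⟨Q, d, hQ, hd, hZd⟩ := exists_diagonalizing_rotation A X
    have hZ := mul_orthogonal_mem_stiefel hX hQ
    suffices hdom : IsDominantFrame (Aᵀ * A) (X * Q) d from
      ⟨X * Q, hdom.isLeadingRightSingularFactor hpn hZ hd, range_mul_orthogonal hQ X⟩
    rcases hcase with hr | rfl | rfl
    · have hpos := inflation_pos_of_isLocalMaxOn hqp hr hX hmax.localize
      rw [← inflation_mul_orthogonal A _ hQ] at hpos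
      exact isDominantFrame_of_isLocalMaxOn hqp hZ hZd hpos
        (isLocalMaxOn_mul_orthogonal hQ hmax.localize)
    · rw [Matrix.mul_zero] at hZd ⊢
      exact isDominantFrame_zero hZd
    · exact isDominantFrame_of_square hZ hZd
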